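/- \textbf{Setting.} Let $(N,h)$ be a smooth Riemannian manifold and let $F$ be a smooth field of endomorphisms of $TN$ with $F^3+F=0$. Put $\mathcal H=\operatorname{Im}F$, $\mathcal V=\ker F$, so that $TN=\mathcal H\oplus\mathcal V$, and let $P=-F^2$ and $q=\mathrm{Id}-P$ be the projectors onto $\mathcal H$ and $\mathcal V$. Assume that $(N,F,h)$ is a Riemannian $f$-manifold, i.e. $\mathcal H\perp\mathcal V$ and $F|_{\mathcal H}$ is orthogonal. A $TN$-valued bilinear form $B$ is identified with the trilinear form $B(X,Y,Z)=\langle B(X,Y),Z\rangle$; "skew-symmetric" means skew-symmetric as a trilinear form; and $\mathrm{Skew}(B)(X,Y,Z)=B(X,Y,Z)+B(Y,Z,X)+B(Z,X,Y)$. For vector fields $X,Y,Z$ set \begin{itemize} \item $N_F(X,Y)=[FX,FY]-F[FX,Y]-F[X,FY]-P[X,Y]$ (Nijenhuis tensor); \item $\Phi(X,Y)=-q[PX,PY]$ and $R_{\mathcal V}(X,Y)=-P[qX,qY]$ (curvatures of $\mathcal H$ and $\mathcal V$); \item $\tilde N_F(X,Y,Z)=N_F(X,Y,Z)+\Phi(X,Y,Z)+R_{\mathcal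 V}(Z,X,Y)+R_{\mathcal V}(Y,Z,X)$ (extended Nijenhuis tensor); \item $\Omega_F(X,Y)=\langle FX,Y\rangle$ and $d^c\Omega_F=-\,d\Omega_F(F\cdot,F\cdot,F\cdot)$, where $d\beta(X,Y,Z)=X\cdot\beta(Y,Z)-\beta([X,Y],Z)+{}$circular permutations, for a 2-form $\beta$. \end{itemize} Let $D$ be the Levi-Civita connection of $h$ and $D\Omega_q(X,Y,Z)=\langle (D_Xq)Y,Z\rangle$. $(N,F,h)$ is \emph{reductive} if the restrictions of $D\Omega_q$ to $\mathcal H\times\mathcal H\times\mathcal V$ and to $\mathcal V\times\mathcal V\times\mathcal H$ are both skew-symmetric in the first two variables. It is of \emph{global type} $\mathcal G_1$ if $\tilde N_F$ is skew-symmetric. A \emph{metric $f$-connection} is a smooth affine connection $\nabla$ on $N$ with $\nabla h=0$ and $\nabla F=0$; its torsion is $T(X,Y)=\nabla_XY-\nabla_YX-[X,Y]$. \textbf{Theorem.} A Riemannian $f$-manifold $(N,F,h)$ admits a metric $f$-connection with skew-symmetric torsion if and only if it is reductive and of global type $\mathcal G_1$. In that case, for every smooth section $\alpha$ of $\Lambda^3\mathcal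 V^*$ there exists a unique metric $f$-connection $\nabla$ with skew-symmetric torsion $T$ such that $T|_{\Lambda^3\mathcal V}=\alpha$. Its torsion is $$T=\bigl(-d^c\Omega_F+N_F|_{\mathcal H^3}\bigr)+\mathrm{Skew}(\Phi)+\mathrm{Skew}(R_{\mathcal V})+\alpha ,$$ where $N_F|_{\mathcal H^3}=N_F(P\cdot,P\cdot,P\cdot)$ and $\alpha$ is extended to $TN$ by $\alpha(q\cdot,q\cdot,q\cdot)$. -/

import Mathlib

open scoped Manifold ContDiff Bundle

noncomputable section

namespace FManifold

section Basic

variable (E : Type*) [NormedAddCommGroup E] [NormedSpace ℝ E]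
  (N : Type*) [TopologicalSpace N] [ChartedSpace E N] [IsManifold 𝓘(ℝ, E) ∞ N]

/-- Vector fields on the manifold `N` (modelled on `E`), without regularity. -/
abbrev VField := Π x : N, TangentSpace 𝓘(ℝ, E) x

/-- Fields of endomorphisms of `TN`, without regularity. -/
abbrev EndField := Π x : N, TangentSpace 𝓘(ℝ, E) x →L[ℝ] TangentSpace 𝓘(ℝ, E) x

/-- Trilinear forms on `N`, given by their values on vector fields. A `TN`-valued bilinear form
`B` is identified with the trilinear form `B(X, Y, Z) = ⟨B(X, Y), Z⟩`. -/
abbrev TriForm := VField E N → VField E N → VField E N → N → ℝ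

/-- Smooth Riemannian metrics on `N`. -/
abbrev Metric :=
  Bundle.ContMDiffRiemannianMetric 𝓘(ℝ, E) ∞ E (fun x : N ↦ TangentSpace 𝓘(ℝ, E) x)

/-- Affine connections on `N`. The value `∇_u X` for `u ∈ T_x N` is `cov X x u`. -/
abbrev Connection := CovariantDerivative 𝓘(ℝ, E) E (fun x : N ↦ TangentSpace 𝓘(ℝ, E) x)

end Basic

section LieFun

variable {E : Type*} [NormedAddCommGroup E] [NormedSpace ℝ E]
  {N : Type*} [TopologicalSpace N] [ChartedSpace E N]

/-- The derivative `X · f` of the function `f` along the vector field `X`. -/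
def lieFun (X : Π x : N, TangentSpace 𝓘(ℝ, E) x) (f : N → ℝ) (x : N) : ℝ := mvfderiv 𝓘(ℝ, E) f x (X x)

lemma lieFun_add (X : Π x : N, TangentSpace 𝓘(ℝ, E) x) {f g : N → ℝ} {x : N}
    (hf : MDifferentiableAt 𝓘(ℝ, E) 𝓘(ℝ, ℝ) f x) (hg : MDifferentiableAt 𝓘(ℝ, E) 𝓘(ℝ, ℝ) g x) :
    lieFun X (f + g) x = lieFun X f x + lieFun X g x := by
  have := mvfderiv_fun_add hf hg
  simp only [lieFun]
  exact congr($this (X x))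

lemma lieFun_mul (X : Π x : N, TangentSpace 𝓘(ℝ, E) x) {f g : N → ℝ} {x : N}
    (hf : MDifferentiableAt 𝓘(ℝ, E) 𝓘(ℝ, ℝ) f x) (hg : MDifferentiableAt 𝓘(ℝ, E) 𝓘(ℝ, ℝ) g x) :
    lieFun X (f * g) x = f x * lieFun X g x + g x * lieFun X f x := by
  have := mvfderiv_fun_mul hf hg
  simp only [lieFun]
  exact congr($this (X x))

end LieFun

variable {E : Type*} [NormedAddCommGroup E] [NormedSpace ℝ E]
  {N : Type*} [TopologicalSpace N] [ChartedSpace E N] [IsManifold 𝓘(ℝ, E) ∞ N]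

/-- The vector field `X` is differentiable at `x`. -/
def DiffAt (X : VField E N) (x : N) : Prop :=
  MDifferentiableAt 𝓘(ℝ, E) 𝓘(ℝ, E).tangent (fun y ↦ (⟨y, X y⟩ : TangentBundle 𝓘(ℝ, E) N)) x

/-- The vector field `X` is smooth at `x`. -/
def SmoothAt (X : VField E N) (x : N) : Prop :=
  ContMDiffAt 𝓘(ℝ, E) 𝓘(ℝ, E).tangent ∞ (fun y ↦ (⟨y, X y⟩ : TangentBundle 𝓘(ℝ, E) N)) x

/-- The vector field `A X`. -/
def EndField.app (A : EndField E N) (X : VField E N) : VField E N := fun x ↦ A x (X x)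

/-- Smooth sections of `End(TN)`. -/
def EndField.IsSmooth (A : EndField E N) : Prop :=
  ContMDiff 𝓘(ℝ, E) (𝓘(ℝ, E).prod 𝓘(ℝ, E →L[ℝ] E)) ∞
    (fun x ↦ Bundle.TotalSpace.mk' (E →L[ℝ] E)
      (E := fun x : N ↦ TangentSpace 𝓘(ℝ, E) x →L[ℝ] TangentSpace 𝓘(ℝ, E) x) x (A x))

/-- The Lie bracket of vector fields. -/
def bracket (X Y : VField E N) : VField E N := VectorField.mlieBracket 𝓘(ℝ, E) X Y

/-! ### Operations on trilinear forms -/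

/-- A trilinear form is skew-symmetric: it changes sign under the transposition of two arguments.
The two transpositions used here generate all permutations. -/
def TriForm.IsSkew (B : TriForm E N) : Prop :=
  ∀ (x : N) (X Y Z : VField E N), DiffAt X x → DiffAt Y x → DiffAt Z x →
    B X Y Z x = -B Y X Z x ∧ B X Y Z x = -B X Z Y x

/-- The sum of the circular permutations. -/
def TriForm.cyc (B : TriForm E N) : TriForm E N :=
  fun X Y Z x ↦ B X Y Z x + B Y Z X x + B Z X Y x

/-- The trilinear form `B(A₁ ·, A₂ ·, A₃ ·)`. -/
def TriForm.comp (B : TriForm E N) (A₁ A₂ A₃ : EndField E N) : TriForm E N :=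
  fun X Y Z ↦ B (A₁.app X) (A₂.app Y) (A₃.app Z)

/-- The exterior derivative of a 2-form `β`, given by its values on vector fields. -/
def extDeriv₂ (β : VField E N → VField E N → N → ℝ) : TriForm E N :=
  fun X Y Z x ↦
    lieFun X (β Y Z) x + lieFun Y (β Z X) x + lieFun Z (β X Y) x
      - β (bracket X Y) Z x - β (bracket Y Z) X x - β (bracket Z X) Y x

/-! ### `f`-structures -/

/-- For an `f`-structure `F`, the projector `P = -F²` onto `ℋ = Im F` along `𝒱 = ker F`. -/
def projH (F : EndField E N) : EndField E N := fun x ↦ -(F x ∘L F x)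

/-- For an `f`-structure `F`, the projector `q = Id - P` onto `𝒱 = ker F` along `ℋ = Im F`. -/
def projV (F : EndField E N) : EndField E N :=
  fun x ↦ ContinuousLinearMap.id ℝ (TangentSpace 𝓘(ℝ, E) x) - projH F x

section Metric

variable (h : Metric E N) (F : EndField E N)

/-- `(N, F, h)` is a Riemannian `f`-manifold: `F` is a smooth `f`-structure (`F³ + F = 0`), the
subbundles `ℋ = Im F` and `𝒱 = ker F` are orthogonal, and `F` restricted to `ℋ` is orthogonal. -/
structure IsRiemannianFStructure : Prop where
  smooth : F.IsSmooth
  cube : ∀ (x : N) (u : TangentSpace 𝓘(ℝ, E) x), F x (F x (F x u)) + F x u = 0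
  orthogonal : ∀ (x : N) (u v : TangentSpace 𝓘(ℝ, E) x), F x v = 0 → h.inner x (F x u) v = 0
  isometry : ∀ (x : N) (u v : TangentSpace 𝓘(ℝ, E) x),
    h.inner x (F x (F x u)) (F x (F x v)) = h.inner x (F x u) (F x v)

/-- The function `⟨X, Y⟩`. -/
def ip (X Y : VField E N) (x : N) : ℝ := h.inner x (X x) (Y x)

/-- The fundamental 2-form `Ω_F(X, Y) = ⟨F X, Y⟩`. -/
def fundForm (X Y : VField E N) : N → ℝ := ip h (F.app X) Y

/-- The Nijenhuis tensor `N_F(X, Y) = [FX, FY] - F[FX, Y] - F[X, FY] - P[X, Y]`, as a trilinear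
form. -/
def nijenhuis : TriForm E N := fun X Y Z ↦
  ip h (bracket (F.app X) (F.app Y) - F.app (bracket (F.app X) Y)
    - F.app (bracket X (F.app Y)) - (projH F).app (bracket X Y)) Z

/-- The curvature `Φ(X, Y) = -q[PX, PY]` of the horizontal subbundle `ℋ`, as a trilinear form. -/
def curvH : TriForm E N := fun X Y Z ↦
  ip h (-(projV F).app (bracket ((projH F).app X) ((projH F).app Y))) Z

/-- The curvature `R_𝒱(X, Y) = -P[qX, qY]` of the vertical subbundle `𝒱`, as a trilinear form. -/
def curvV : TriForm E N := fun X Y Z ↦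
  ip h (-(projH F).app (bracket ((projV F).app X) ((projV F).app Y))) Z

/-- The extended Nijenhuis tensor
`Ñ_F(X, Y, Z) = N_F(X, Y, Z) + Φ(X, Y, Z) + R_𝒱(Z, X, Y) + R_𝒱(Y, Z, X)`. -/
def extNijenhuis : TriForm E N := fun X Y Z x ↦
  nijenhuis h F X Y Z x + curvH h F X Y Z x + curvV h F Z X Y x + curvV h F Y Z X x

/-- `(N, F, h)` is of global type `𝒢₁`. -/
def IsGlobalTypeG1 : Prop := (extNijenhuis h F).IsSkew

/-- `d^c Ω_F = -(dΩ_F)(F ·, F ·, F ·)`. -/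
def dcFundForm : TriForm E N := fun X Y Z x ↦
  -(extDeriv₂ (fundForm h F)).comp F F F X Y Z x

/-! ### Connections -/

/-- `∇` is metric: `∇h = 0`. -/
def IsMetricConnection (cov : Connection E N) : Prop :=
  ∀ (x : N) (X Y : VField E N) (u : TangentSpace 𝓘(ℝ, E) x), DiffAt X x → DiffAt Y x →
    mvfderiv 𝓘(ℝ, E) (ip h X Y) x u
      = h.inner x (cov X x u) (Y x) + h.inner x (X x) (cov Y x u)

/-- `∇` is an `f`-connection: `∇F = 0`. -/
def IsFConnection (cov : Connection E N) : Prop :=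
  ∀ (x : N) (X : VField E N) (u : TangentSpace 𝓘(ℝ, E) x), DiffAt X x →
    cov (F.app X) x u = F x (cov X x u)

/-! ### The Levi-Civita connection -/

lemma ip_mdiffAt {X Y : VField E N} {x : N} (hX : DiffAt X x) (hY : DiffAt Y x) :
    MDifferentiableAt 𝓘(ℝ, E) 𝓘(ℝ, ℝ) (ip h X Y) x := by
  have h1 := (h.contMDiff.contMDiffAt (x := x)).mdifferentiableAt (by simp)
  have h2 : MDifferentiableAt 𝓘(ℝ, E) (𝓘(ℝ, E).prod 𝓘(ℝ, ℝ))
      (fun m ↦ Bundle.TotalSpace.mk' ℝ (E := Bundle.Trivial N ℝ) m (h.inner m (X m) (Y m))) x :=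
    MDifferentiableAt.clm_bundle_apply (F₁ := E) (F₂ := ℝ)
      (MDifferentiableAt.clm_bundle_apply (F₁ := E) (F₂ := E →L[ℝ] ℝ) h1 hX) hY
  simp only [mdifferentiableAt_totalSpace] at h2
  exact h2.2

lemma ip_comm (X Y : VField E N) : ip h X Y = ip h Y X := by
  funext x; exact h.symm x _ _

lemma ip_add_left (X X' Y : VField E N) : ip h (X + X') Y = ip h X Y + ip h X' Y := by
  funext x; simp [ip]

lemma ip_smul_left (f : N → ℝ) (X Y : VField E N) : ip h (f • X) Y = f * ip h X Y := by
  funext x; simp [ip]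

lemma ip_add_right (X Y Y' : VField E N) : ip h X (Y + Y') = ip h X Y + ip h X Y' := by
  funext x; simp [ip]

lemma ip_smul_right (f : N → ℝ) (X Y : VField E N) : ip h X (f • Y) = f * ip h X Y := by
  funext x; simp [ip]

/-- The right hand side of the Koszul formula, which equals `2⟨D_X Y, Z⟩` for the Levi-Civita
connection `D`. -/
def koszul (X Y Z : VField E N) (x : N) : ℝ :=
  lieFun X (ip h Y Z) x + lieFun Y (ip h X Z) x - lieFun Z (ip h X Y) x
    + ip h (bracket X Y) Z x - ip h (bracket X Z) Y x - ip h (bracket Y Z) X x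

lemma inner_injective (x : N) : Function.Injective (h.inner x) := by
  refine (injective_iff_map_eq_zero _).2 fun u hu ↦ ?_
  by_contra hne
  have := h.pos x u hne
  rw [hu] at this
  simp at this

lemma ext_inner {x : N} {u v : TangentSpace 𝓘(ℝ, E) x}
    (huv : ∀ Z : VField E N, DiffAt Z x → h.inner x u (Z x) = h.inner x v (Z x)) : u = v := by
  apply inner_injective h x
  ext w
  have := huv (FiberBundle.extend E w) (FiberBundle.mdifferentiableAt_extend ..)
  simpa using this

lemma ext_field {x : N} {A B : TangentSpace 𝓘(ℝ, E) x →L[ℝ] TangentSpace 𝓘(ℝ, E) x}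
    (hAB : ∀ X : VField E N, DiffAt X x → A (X x) = B (X x)) : A = B := by
  ext w
  have := hAB (FiberBundle.extend E w) (FiberBundle.mdifferentiableAt_extend ..)
  simpa using this

variable [FiniteDimensional ℝ E]

lemma koszul_add_X {X X' Y Z : VField E N} {x : N} (hX : DiffAt X x) (hX' : DiffAt X' x)
    (hY : DiffAt Y x) (hZ : DiffAt Z x) :
    koszul h (X + X') Y Z x = koszul h X Y Z x + koszul h X' Y Z x := by
  simp only [koszul, ip_add_left, ip_add_right]
  rw [lieFun_add _ (ip_mdiffAt h hX hZ) (ip_mdiffAt h hX' hZ),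
    lieFun_add _ (ip_mdiffAt h hX hY) (ip_mdiffAt h hX' hY)]
  simp only [lieFun, ip, bracket, VectorField.mlieBracket_add_left hX hX', Pi.add_apply, map_add,
    add_apply]
  ring

lemma koszul_smul_X {f : N → ℝ} {X Y Z : VField E N} {x : N}
    (hf : MDifferentiableAt 𝓘(ℝ, E) 𝓘(ℝ, ℝ) f x) (hX : DiffAt X x)
    (hY : DiffAt Y x) (hZ : DiffAt Z x) :
    koszul h (f • X) Y Z x = f x * koszul h X Y Z x := by
  simp only [koszul, ip_smul_left, ip_smul_right]
  rw [lieFun_mul _ hf (ip_mdiffAt h hX hZ), lieFun_mul _ hf (ip_mdiffAt h hX hY)]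
  simp only [lieFun, ip, bracket, VectorField.mlieBracket_smul_left hf hX, Pi.smul_apply',
    Pi.mul_apply, map_add, map_smul, map_neg,
    add_apply, smul_apply, smul_eq_mul, neg_smul,
    neg_apply]
  rw [h.symm x (X x) (Z x), h.symm x (X x) (Y x)]
  ring

lemma koszul_add_Z {X Y Z Z' : VField E N} {x : N} (hX : DiffAt X x)
    (hY : DiffAt Y x) (hZ : DiffAt Z x) (hZ' : DiffAt Z' x) :
    koszul h X Y (Z + Z') x = koszul h X Y Z x + koszul h X Y Z' x := by
  simp only [koszul, ip_add_right]
  rw [lieFun_add _ (ip_mdiffAt h hX hZ) (ip_mdiffAt h hX hZ'),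
    lieFun_add _ (ip_mdiffAt h hY hZ) (ip_mdiffAt h hY hZ')]
  simp only [lieFun, ip, bracket, VectorField.mlieBracket_add_right hZ hZ', Pi.add_apply, map_add,
    add_apply]
  ring

lemma koszul_smul_Z {f : N → ℝ} {X Y Z : VField E N} {x : N}
    (hf : MDifferentiableAt 𝓘(ℝ, E) 𝓘(ℝ, ℝ) f x) (hX : DiffAt X x)
    (hY : DiffAt Y x) (hZ : DiffAt Z x) :
    koszul h X Y (f • Z) x = f x * koszul h X Y Z x := by
  simp only [koszul, ip_smul_right]
  rw [lieFun_mul _ hf (ip_mdiffAt h hX hZ), lieFun_mul _ hf (ip_mdiffAt h hY hZ)]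
  simp only [lieFun, ip, bracket, VectorField.mlieBracket_smul_right hf hZ, Pi.smul_apply', Pi.mul_apply,
    map_add, map_smul,
    add_apply, smul_apply, smul_eq_mul]
  rw [h.symm x (X x) (Z x), h.symm x (Y x) (Z x)]
  ring

lemma koszul_add_Y {X Y Y' Z : VField E N} {x : N} (hX : DiffAt X x)
    (hY : DiffAt Y x) (hY' : DiffAt Y' x) (hZ : DiffAt Z x) :
    koszul h X (Y + Y') Z x = koszul h X Y Z x + koszul h X Y' Z x := by
  simp only [koszul, ip_add_left, ip_add_right]
  rw [lieFun_add _ (ip_mdiffAt h hY hZ) (ip_mdiffAt h hY' hZ),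
    lieFun_add _ (ip_mdiffAt h hX hY) (ip_mdiffAt h hX hY')]
  simp only [lieFun, ip, bracket, VectorField.mlieBracket_add_right hY hY',
    VectorField.mlieBracket_add_left hY hY', Pi.add_apply, map_add,
    add_apply]
  ring

lemma koszul_smul_Y {f : N → ℝ} {X Y Z : VField E N} {x : N}
    (hf : MDifferentiableAt 𝓘(ℝ, E) 𝓘(ℝ, ℝ) f x) (hX : DiffAt X x)
    (hY : DiffAt Y x) (hZ : DiffAt Z x) :
    koszul h X (f • Y) Z x = f x * koszul h X Y Z x + 2 * (lieFun X f x * ip h Y Z x) := by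
  simp only [koszul, ip_smul_left, ip_smul_right]
  rw [lieFun_mul _ hf (ip_mdiffAt h hX hY), lieFun_mul _ hf (ip_mdiffAt h hY hZ)]
  simp only [lieFun, ip, bracket, VectorField.mlieBracket_smul_right hf hY,
    VectorField.mlieBracket_smul_left hf hY, Pi.smul_apply', Pi.mul_apply,
    map_add, map_smul, map_neg, neg_smul,
    add_apply, smul_apply, smul_eq_mul,
    neg_apply]
  rw [h.symm x (Y x) (X x)]
  ring

/-- For `Y` differentiable at `x`, the bilinear form `(X, Z) ↦ 2⟨D_X Y, Z⟩` on `T_x N`. -/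
def koszulForm {Y : VField E N} {x : N} (hY : DiffAt Y x) :
    TangentSpace 𝓘(ℝ, E) x →L[ℝ] TangentSpace 𝓘(ℝ, E) x →L[ℝ] ℝ :=
  TensorialAt.mkHom₂ (I := 𝓘(ℝ, E)) (F := E) (F' := E)
    (V := fun x : N ↦ TangentSpace 𝓘(ℝ, E) x) (V' := fun x : N ↦ TangentSpace 𝓘(ℝ, E) x)
    (fun X Z ↦ koszul h X Y Z x) x
    (fun _ hZ ↦ ⟨fun hf hX ↦ koszul_smul_X h hf hX hY hZ,
      fun hX hX' ↦ koszul_add_X h hX hX' hY hZ⟩)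
    (fun _ hX ↦ ⟨fun hf hZ ↦ koszul_smul_Z h hf hX hY hZ,
      fun hZ hZ' ↦ koszul_add_Z h hX hY hZ hZ'⟩)

lemma koszulForm_apply {X Y Z : VField E N} {x : N} (hX : DiffAt X x)
    (hY : DiffAt Y x) (hZ : DiffAt Z x) :
    koszulForm h hY (X x) (Z x) = koszul h X Y Z x :=
  TensorialAt.mkHom₂_apply _ _ hX hZ

/-- The musical isomorphism `T_x N ≃ T_x^* N` defined by the metric. -/
def flat (x : N) : TangentSpace 𝓘(ℝ, E) x ≃L[ℝ] (TangentSpace 𝓘(ℝ, E) x →L[ℝ] ℝ) :=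
  haveI : FiniteDimensional ℝ (TangentSpace 𝓘(ℝ, E) x) := inferInstanceAs (FiniteDimensional ℝ E)
  haveI : FiniteDimensional ℝ (TangentSpace 𝓘(ℝ, E) x →L[ℝ] ℝ) :=
    inferInstanceAs (FiniteDimensional ℝ (E →L[ℝ] ℝ))
  haveI : T2Space (TangentSpace 𝓘(ℝ, E) x) := inferInstanceAs (T2Space E)
  (LinearEquiv.ofInjectiveOfFinrankEq (h.inner x).toLinearMap (inner_injective h x)
    ((Subspace.dual_finrank_eq (K := ℝ) (V := TangentSpace 𝓘(ℝ, E) x)).symm.trans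
      (LinearMap.toContinuousLinearMap (𝕜 := ℝ) (E := TangentSpace 𝓘(ℝ, E) x)
        (F' := ℝ)).finrank_eq)).toContinuousLinearEquiv

lemma inner_flat_symm (x : N) (l : TangentSpace 𝓘(ℝ, E) x →L[ℝ] ℝ) (v : TangentSpace 𝓘(ℝ, E) x) :
    h.inner x ((flat h x).symm l) v = l v :=
  congr($((flat h x).apply_symm_apply l) v)

open Classical in
/-- The covariant derivative `D` of the Levi-Civita connection, given by the Koszul formula on
differentiable vector fields (and by `0` otherwise). -/
def leviCivitaFun (Y : VField E N) (x : N) :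
    TangentSpace 𝓘(ℝ, E) x →L[ℝ] TangentSpace 𝓘(ℝ, E) x :=
  if hY : DiffAt Y x then
    (flat h x).symm.toContinuousLinearMap ∘L ((1 / 2 : ℝ) • koszulForm h hY)
  else 0

lemma inner_leviCivitaFun {X Y Z : VField E N} {x : N} (hX : DiffAt X x) (hY : DiffAt Y x)
    (hZ : DiffAt Z x) :
    h.inner x (leviCivitaFun h Y x (X x)) (Z x) = 1 / 2 * koszul h X Y Z x := by
  rw [← koszulForm_apply h hX hY hZ]
  simp [leviCivitaFun, hY, inner_flat_symm]

/-- The Levi-Civita connection of `(N, h)`. -/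
def leviCivita : Connection E N where
  toFun := leviCivitaFun h
  isCovariantDerivativeOnUniv :=
    { add := by
        intro Y Y' x hY hY' _
        refine ext_field fun X hX ↦ ext_inner h fun Z hZ ↦ ?_
        have hs : DiffAt (Y + Y') x := mdifferentiableAt_add_section hY hY'
        rw [inner_leviCivitaFun h hX hs hZ, koszul_add_Y h hX hY hY' hZ]
        simp only [add_apply, map_add]
        rw [inner_leviCivitaFun h hX hY hZ, inner_leviCivitaFun h hX hY' hZ]
        ring
      leibniz := by
        intro Y f x hY hf _
        refine ext_field fun X hX ↦ ext_inner h fun Z hZ ↦ ?_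
        have hs : DiffAt (f • Y) x := hf.smul_section hY
        rw [inner_leviCivitaFun h hX hs hZ, koszul_smul_Y h hf hX hY hZ]
        simp only [add_apply, smul_apply, map_add, map_smul, smul_eq_mul,
          ContinuousLinearMap.smulRight_apply]
        rw [inner_leviCivitaFun h hX hY hZ]
        simp only [lieFun, ip]
        ring }

lemma inner_leviCivita {X Y Z : VField E N} {x : N} (hX : DiffAt X x) (hY : DiffAt Y x)
    (hZ : DiffAt Z x) :
    h.inner x (leviCivita h Y x (X x)) (Z x) = 1 / 2 * koszul h X Y Z x :=
  inner_leviCivitaFun h hX hY hZ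

theorem leviCivita_metric : IsMetricConnection h (leviCivita h) := by
  intro x X Y u hX hY
  obtain ⟨U, hU, rfl⟩ : ∃ U : VField E N, DiffAt U x ∧ U x = u :=
    ⟨FiberBundle.extend E u, FiberBundle.mdifferentiableAt_extend .., by simp⟩
  rw [h.symm x (X x), inner_leviCivita h hU hX hY, inner_leviCivita h hU hY hX]
  simp only [koszul, ip_comm h Y X, bracket]
  rw [VectorField.mlieBracket_swap (V := Y) (W := X)]
  simp only [lieFun, ip, Pi.neg_apply, map_neg, neg_apply]
  ring

theorem leviCivita_torsion (x : N) : (leviCivita h).torsion x = 0 := by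
  have key : (leviCivita h).torsion = 0 := by
    rw [CovariantDerivative.torsion_eq_zero_iff]
    intro X Y x hX hY
    refine ext_inner h fun Z hZ ↦ ?_
    rw [map_sub, sub_apply, inner_leviCivita h hX hY hZ, inner_leviCivita h hY hX hZ]
    simp only [koszul, ip_comm h Y X, bracket]
    rw [VectorField.mlieBracket_swap (V := Y) (W := X)]
    simp only [lieFun, ip, Pi.neg_apply, map_neg, neg_apply]
    ring
  rw [key]; rfl

/-! ### Reductive `f`-manifolds and characteristic connections -/

/-- `Dq` for the Levi-Civita connection `D`, as the trilinear form
`(DΩ_q)(X, Y, Z) = ⟨(D_X q) Y, Z⟩ = ⟨D_X (q Y) - q (D_X Y), Z⟩`. -/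
def derivProjV : TriForm E N := fun X Y Z x ↦
  h.inner x (leviCivita h ((projV F).app Y) x (X x) - projV F x (leviCivita h Y x (X x))) (Z x)

/-- Type `ℋ²𝒱`: the restriction of `DΩ_q` to `ℋ × ℋ × 𝒱` is skew-symmetric in the first two
variables. -/
def IsTypeH2V : Prop :=
  ∀ (x : N) (X Y Z : VField E N), DiffAt X x → DiffAt Y x → DiffAt Z x →
    (derivProjV h F).comp (projH F) (projH F) (projV F) X Y Z x
      = -(derivProjV h F).comp (projH F) (projH F) (projV F) Y X Z x

/-- Type `𝒱²ℋ`: the restriction of `DΩ_q` to `𝒱 × 𝒱 × ℋ` is skew-symmetric in the first two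
variables. -/
def IsTypeV2H : Prop :=
  ∀ (x : N) (X Y Z : VField E N), DiffAt X x → DiffAt Y x → DiffAt Z x →
    (derivProjV h F).comp (projV F) (projV F) (projH F) X Y Z x
      = -(derivProjV h F).comp (projV F) (projV F) (projH F) Y X Z x

/-- `(N, F, h)` is reductive. -/
def IsReductive : Prop := IsTypeH2V h F ∧ IsTypeV2H h F

/-- The torsion of `∇`, as a trilinear form. -/
def torsionForm (cov : Connection E N) : TriForm E N := fun X Y Z x ↦
  h.inner x (cov.torsion x (X x) (Y x)) (Z x)

/-- `∇` is a (smooth) metric `f`-connection with skew-symmetric torsion. -/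
structure IsCharacteristic (cov : Connection E N) : Prop where
  smooth : cov.ContMDiffCovariantDerivative ∞
  metric : IsMetricConnection h cov
  parallel : IsFConnection F cov
  skew : (torsionForm h cov).IsSkew

end Metric

/-- Smooth sections of `Λ³𝒱*`, considered as 3-forms on `N` which vanish as soon as one argument
is horizontal. -/
structure VerticalThreeForm (F : EndField E N) where
  /-- The underlying 3-form on `N`. -/
  toFun : Π x : N, TangentSpace 𝓘(ℝ, E) x [⋀^Fin 3]→L[ℝ] ℝ
  smooth : ∀ (x : N) (X Y Z : VField E N), SmoothAt X x → SmoothAt Y x → SmoothAt Z x →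
    ContMDiffAt 𝓘(ℝ, E) 𝓘(ℝ, ℝ) ∞ (fun y ↦ toFun y ![X y, Y y, Z y]) x
  vertical : ∀ (x : N) (u v w : TangentSpace 𝓘(ℝ, E) x),
    toFun x ![u, v, w] = toFun x ![projV F x u, projV F x v, projV F x w]

/-- The trilinear form of a vertical 3-form. -/
def VerticalThreeForm.form {F : EndField E N} (α : VerticalThreeForm F) : TriForm E N :=
  fun X Y Z x ↦ α.toFun x ![X x, Y x, Z x]

/-- Equality of trilinear forms, tested on differentiable vector fields. -/
def TriForm.Agrees (B B' : TriForm E N) : Prop :=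
  ∀ (x : N) (X Y Z : VField E N), DiffAt X x → DiffAt Y x → DiffAt Z x → B X Y Z x = B' X Y Z x

/-- Equality of connections, tested on differentiable vector fields (the values of a
`CovariantDerivative` elsewhere carry no information). -/
def SameConnection (cov cov' : Connection E N) : Prop :=
  ∀ (x : N) (X : VField E N), DiffAt X x → cov X x = cov' X x

end FManifold

end

noncomputable section

namespace FManifold

open scoped Topology

/-! ### Trilinear algebra on a vector space with an `f`-structure -/

section Algebra

variable {V : Type*} [AddCommGroup V] [Module ℝ V]

/-! Everything is governed by the tensor A(X, Y, Z) = ⟨(D_X F)Y, Z⟩, `derivF` below. A metric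
connection with skew torsion T is D + T/2 by the Koszul formula (`inner_eq_of_isMetricConnection`),
so ∇F = 0 becomes the pointwise linear equation 2A(X, Y, Z) = -(T(X, FY, Z) + T(X, Y, FZ))
(`isFConnection_iff`). Since D is torsion-free, dΩ_F, N_F, Φ, R_𝒱 and Dq are also linear expressions
in A. What remains is trilinear algebra on one vector space.

Necessity and uniqueness: substituting the equation, Φ is the ℋℋ𝒱 part of T and R_𝒱 its 𝒱𝒱ℋ part,
while Dq on the two blocks of the reductivity condition is ±1/2 of these parts. In Ñ_F the curvature
terms restore exactly the part of T(X, Y, qZ) missing from N_F, apart from the purely vertical part,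
and what is left is visibly skew. On ℋ³, -d^cΩ_F contributes the terms T(FX, FY, Z) + T(FX, Y, FZ) +
T(X, FY, FZ) that N_F subtracts, so T is the stated formula (`eq_algT_of_isParallelEq`).

Sufficiency: take T to be the formula. It is skew because N_F is skew on ℋ³ (`isSkew_algT`), and it
solves the equation by a check on horizontal and vertical arguments (`isParallelEq_algT`). The
delicate type is X vertical with Y, Z horizontal, where `mixed_of_isSkew_algExt` combines both
hypotheses. The connection is then D + T/2; it is smooth because its inner products with smooth
fields are. -/

/-- A trilinear form given by a function which is linear in each argument. -/
def trilinearMk (f : V → V → V → ℝ)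
    (add₁ : ∀ a b v w, f (a + b) v w = f a v w + f b v w)
    (smul₁ : ∀ (c : ℝ) a v w, f (c • a) v w = c * f a v w)
    (add₂ : ∀ u a b w, f u (a + b) w = f u a w + f u b w)
    (smul₂ : ∀ (c : ℝ) u a w, f u (c • a) w = c * f u a w)
    (add₃ : ∀ u v a b, f u v (a + b) = f u v a + f u v b)
    (smul₃ : ∀ (c : ℝ) u v a, f u v (c • a) = c * f u v a) :
    V →ₗ[ℝ] V →ₗ[ℝ] V →ₗ[ℝ] ℝ :=
  LinearMap.mk₂ ℝ
    (fun u v ↦ { toFun := f u v, map_add' := add₃ u v, map_smul' := fun c ↦ smul₃ c u v })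
    (fun a b v ↦ LinearMap.ext fun w ↦ add₁ a b v w)
    (fun c a v ↦ LinearMap.ext fun w ↦ smul₁ c a v w)
    (fun u a b ↦ LinearMap.ext fun w ↦ add₂ u a b w)
    (fun c u a ↦ LinearMap.ext fun w ↦ smul₂ c u a w)

/-- The invariance under permutations, up to sign, of a trilinear form. -/
def IsSkew₃ (B : V → V → V → ℝ) : Prop :=
  ∀ X Y Z, B X Y Z = -B Y X Z ∧ B X Y Z = -B X Z Y

variable (F : V →ₗ[ℝ] V) (A : V →ₗ[ℝ] V →ₗ[ℝ] V →ₗ[ℝ] ℝ)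

/-- The algebraic properties of `A(X, Y, Z) = ⟨(D_X F) Y, Z⟩`. -/
structure IsDerivOfF : Prop where
  cube : ∀ v, F (F (F v)) = -F v
  skew : ∀ X Y Z, A X Y Z = -A X Z Y
  deriv : ∀ X Y Z, A X (F (F Y)) Z - A X (F Y) (F Z) + A X Y (F (F Z)) + A X Y Z = 0

/-- The projector `-F²`. -/
def pH : V →ₗ[ℝ] V := -(F ∘ₗ F)

/-- The projector `Id + F²`. -/
def pV : V →ₗ[ℝ] V := LinearMap.id - pH F

lemma pH_apply (v : V) : pH F v = -F (F v) := rfl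

lemma pV_apply (v : V) : pV F v = v - pH F v := rfl

/-- The exterior derivative of the fundamental form in terms of `DF`. -/
def algD (X Y Z : V) : ℝ := A X Y Z + A Y Z X + A Z X Y

/-- The Nijenhuis tensor in terms of `DF`. -/
def algN (X Y Z : V) : ℝ := A (F X) Y Z - A (F Y) X Z + A X Y (F Z) - A Y X (F Z)

/-- The curvature of the horizontal bundle in terms of `DF`. -/
def algPhi (X Y Z : V) : ℝ := A (pH F X) (F Y) (pV F Z) - A (pH F Y) (F X) (pV F Z)

/-- The curvature of the vertical bundle in terms of `DF`. -/
def algR (X Y Z : V) : ℝ := A (pV F X) (pV F Y) (F Z) - A (pV F Y) (pV F X) (F Z)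

/-- The covariant derivative of the vertical projector in terms of `DF`. -/
def algQ (X Y Z : V) : ℝ := A X (F Y) Z - A X Y (F Z)

/-- The extended Nijenhuis tensor in terms of `DF`. -/
def algExt (X Y Z : V) : ℝ :=
  algN F A X Y Z + algPhi F A X Y Z + algR F A Z X Y + algR F A Y Z X

/-- The torsion of the characteristic connection in terms of `DF`. -/
def algT (α : V →ₗ[ℝ] V →ₗ[ℝ] V →ₗ[ℝ] ℝ) (X Y Z : V) : ℝ :=
  algD A (F X) (F Y) (F Z) + algN F A (pH F X) (pH F Y) (pH F Z)
    + (algPhi F A X Y Z + algPhi F A Y Z X + algPhi F A Z X Y)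
    + (algR F A X Y Z + algR F A Y Z X + algR F A Z X Y) + α X Y Z

/-- The equation expressing that the metric connection with torsion `T` preserves `F`. -/
def IsParallelEq (T : V → V → V → ℝ) : Prop :=
  ∀ X Y Z, 2 * A X Y Z = -(T X (F Y) Z + T X Y (F Z))

/-- The pointwise version of reductivity. -/
def AlgReductive : Prop :=
  (∀ X Y Z, algQ F A (pH F X) (pH F Y) (pV F Z) = -algQ F A (pH F Y) (pH F X) (pV F Z)) ∧
  (∀ X Y Z, algQ F A (pV F X) (pV F Y) (pH F Z) = -algQ F A (pV F Y) (pV F X) (pH F Z))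

variable {F A}

/-! ### Necessity: consequences of the equation ∇F = 0 for a skew torsion. -/

section Necessity

variable {T : V →ₗ[ℝ] V →ₗ[ℝ] V →ₗ[ℝ] ℝ}

lemma IsParallelEq.eq (hE : IsParallelEq F A (fun X Y Z ↦ T X Y Z)) (X Y Z : V) :
    A X Y Z = -(T X (F Y) Z + T X Y (F Z)) / 2 := by
  linarith [hE X Y Z]

variable (hA : IsDerivOfF F A) (hT : IsSkew₃ fun X Y Z ↦ T X Y Z)
  (hE : IsParallelEq F A (fun X Y Z ↦ T X Y Z))
include hA hT hE

/-- Since Fq = 0 and F² = -P, the equation gives 2A(PX, FY, qZ) = T(PX, PY, qZ); skewness of T makes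
the two halves add up. -/
lemma algPhi_eq_of_isParallelEq (X Y Z : V) :
    algPhi F A X Y Z = T (pH F X) (pH F Y) (pV F Z) := by
  have h := (hT (pH F X) (pH F Y) (pV F Z)).1
  simp only [algPhi, hE.eq, pV_apply, pH_apply, map_sub, map_neg, hA.cube,
    LinearMap.neg_apply] at h ⊢
  linarith

lemma algR_eq_of_isParallelEq (X Y Z : V) :
    algR F A X Y Z = T (pV F X) (pV F Y) (pH F Z) := by
  have h := (hT (pV F X) (pV F Y) (pH F Z)).1
  simp only [algR, hE.eq, pV_apply, pH_apply, map_sub, map_neg, hA.cube,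
    LinearMap.sub_apply, LinearMap.neg_apply] at h ⊢
  linarith

-- Each of the four terms of `algN` yields two values of T with coefficient 1/2. By skewness the
-- eight values agree in pairs, which removes the halves.
omit hA in
lemma algN_eq_of_isParallelEq (X Y Z : V) :
    algN F A X Y Z = T X Y (pH F Z)
      - (T (F X) (F Y) Z + T (F X) Y (F Z) + T X (F Y) (F Z)) := by
  have h1 := (hT (F X) (F Y) Z).1
  have h2 := (hT (F X) Y (F Z)).1
  have h3 := (hT X (F Y) (F Z)).1
  have h4 := (hT X Y (F (F Z))).1
  simp only [algN, hE.eq, pH_apply, map_neg] at h1 h2 h3 h4 ⊢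
  linarith

/-- N_F contributes T(X, Y, PZ). The three curvature terms are the ℋℋ𝒱, 𝒱ℋ𝒱 and ℋ𝒱𝒱 parts of T, so
together they complete it to T minus its vertical part. This explains the choice of terms in the
extended tensor. -/
lemma algExt_eq_of_isParallelEq (X Y Z : V) :
    algExt F A X Y Z = T X Y Z - T (pV F X) (pV F Y) (pV F Z)
      - (T (F X) (F Y) Z + T (F X) Y (F Z) + T X (F Y) (F Z)) := by
  simp only [algExt, algN_eq_of_isParallelEq hT hE, algPhi_eq_of_isParallelEq hA hT hE,
    algR_eq_of_isParallelEq hA hT hE]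
  have h1 := (hT (pV F Z) (pV F X) (pH F Y)).1
  have h2 := (hT (pV F X) (pV F Z) (pH F Y)).2
  have h3 := (hT (pV F Y) (pV F Z) (pH F X)).2
  have h4 := (hT (pV F Y) (pH F X) (pV F Z)).1
  simp only at h1 h2 h3 h4
  rw [h1, h2, h3, h4]
  simp only [pV_apply, map_sub, LinearMap.sub_apply]
  ring

theorem isSkew_algExt_of_isParallelEq : IsSkew₃ (algExt F A) := by
  intro X Y Z
  simp only [algExt_eq_of_isParallelEq hA hT hE]
  constructor
  · linarith [(hT X Y Z).1, (hT (pV F X) (pV F Y) (pV F Z)).1, (hT (F X) (F Y) Z).1,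
      (hT (F X) Y (F Z)).1, (hT X (F Y) (F Z)).1]
  · linarith [(hT X Y Z).2, (hT (pV F X) (pV F Y) (pV F Z)).2, (hT (F X) (F Y) Z).2,
      (hT (F X) Y (F Z)).2, (hT X (F Y) (F Z)).2]

/-- On these blocks `algQ` is T/2 and -T/2 respectively, so it inherits the skewness of T. -/
theorem algReductive_of_isParallelEq : AlgReductive F A := by
  constructor
  · intro X Y Z
    have h := (hT (pH F X) (pH F Y) (pV F Z)).1
    simp only [algQ, hE.eq, pV_apply, pH_apply, map_sub, map_neg, hA.cube,
      LinearMap.neg_apply] at h ⊢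
    linarith
  · intro X Y Z
    have h := (hT (pV F X) (pV F Y) (pH F Z)).1
    simp only [algQ, hE.eq, pV_apply, pH_apply, map_sub, map_neg, hA.cube,
      LinearMap.sub_apply, LinearMap.neg_apply] at h ⊢
    linarith

/-- A skew T is the sum of its ℋ³ part, the cyclic sums of its ℋℋ𝒱 and 𝒱𝒱ℋ parts, and its 𝒱³ part.
The mixed parts are Φ and R_𝒱. On ℋ³ the `algD` term equals the sum of the values of T with two F's,
which cancels the one in `algN`. -/
theorem eq_algT_of_isParallelEq {α : V →ₗ[ℝ] V →ₗ[ℝ] V →ₗ[ℝ] ℝ}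
    (hα : ∀ X Y Z, T (pV F X) (pV F Y) (pV F Z) = α X Y Z) (X Y Z : V) :
    T X Y Z = algT F A α X Y Z := by
  simp only [algT, algD, algN_eq_of_isParallelEq hT hE, algPhi_eq_of_isParallelEq hA hT hE,
    algR_eq_of_isParallelEq hA hT hE, ← hα]
  have cyc : ∀ X Y Z, T Y Z X = T X Y Z := fun X Y Z ↦ by linarith [(hT Y Z X).2, (hT Y X Z).1]
  have cyc' : ∀ X Y Z, T Z X Y = T X Y Z := fun X Y Z ↦ (cyc Z X Y).symm
  rw [cyc (pV F X) (pH F Y) (pH F Z), cyc' (pH F X) (pV F Y) (pH F Z),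
    cyc (pH F X) (pV F Y) (pV F Z), cyc' (pV F X) (pH F Y) (pV F Z)]
  have h1 := cyc (F X) (F Y) (F (F Z))
  have h2 := cyc (F (F X)) (F Y) (F Z)
  have h3 := cyc' (F (F X)) (F Y) (F Z)
  have h4 := cyc' (F X) (F (F Y)) (F Z)
  simp only [hE.eq, pV_apply, pH_apply, map_sub, map_neg, hA.cube,
      LinearMap.sub_apply, LinearMap.neg_apply]
  linarith

end Necessity

/-! ### Sufficiency: the explicit torsion is skew and solves the equation ∇F = 0. -/

section Sufficiency

/-- A function which is additive in each of its three arguments vanishes as soon as it vanishes on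
vectors which are horizontal or vertical. -/
lemma eq_zero_of_horizontal_or_vertical (hF : ∀ v, F (F (F v)) = -F v) {G : V → V → V → ℝ}
    (add₁ : ∀ a b v w, G (a + b) v w = G a v w + G b v w)
    (add₂ : ∀ u a b w, G u (a + b) w = G u a w + G u b w)
    (add₃ : ∀ u v a b, G u v (a + b) = G u v a + G u v b)
    (hG : ∀ u v w, (F (F u) = -u ∨ F u = 0) → (F (F v) = -v ∨ F v = 0) →
      (F (F w) = -w ∨ F w = 0) → G u v w = 0) (X Y Z : V) : G X Y Z = 0 := by
  have hs : ∀ v, v = pH F v + pV F v := fun v ↦ by simp [pV_apply]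
  have hH : ∀ v, F (F (pH F v)) = -pH F v ∨ F (pH F v) = 0 := fun v ↦ by
    left; simp [pH_apply, hF]
  have hV : ∀ v, F (F (pV F v)) = -pV F v ∨ F (pV F v) = 0 := fun v ↦ by
    right; simp [pV_apply, pH_apply, hF]
  rw [hs X, hs Y, hs Z]
  simp only [add₁, add₂, add₃, hG, hH, hV, add_zero]

variable (hA : IsDerivOfF F A)
include hA

lemma IsDerivOfF.eq_zero_of_vertical {X Y Z : V} (hY : F Y = 0) (hZ : F Z = 0) :
    A X Y Z = 0 := by
  simpa [hY, hZ] using hA.deriv X Y Z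

/-- On ℋ the map F is a complex structure, and the derivative of F² = -1 says that the ℋ-component
of D_X F anticommutes with F. -/
lemma IsDerivOfF.apply_apply_of_horizontal {X Y Z : V} (hY : F (F Y) = -Y) (hZ : F (F Z) = -Z) :
    A X (F Y) (F Z) = -A X Y Z := by
  have h := hA.deriv X Y Z
  simp only [hY, hZ, map_neg, LinearMap.neg_apply] at h
  linarith

lemma IsDerivOfF.apply_comm_of_horizontal {X Y Z : V} (hY : F (F Y) = -Y) (hZ : F (F Z) = -Z) :
    A X (F Y) Z = A X Y (F Z) := by
  have h := hA.apply_apply_of_horizontal (X := X) hY (Z := F Z) (by rw [hZ, map_neg])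
  simp only [hZ, map_neg] at h
  linarith

variable (hR : AlgReductive F A)
include hR

omit hA in
lemma AlgReductive.horizontal {X Y Z : V} (hX : F (F X) = -X) (hY : F (F Y) = -Y) (hZ : F Z = 0) :
    A X (F Y) Z = -A Y (F X) Z := by
  have h := hR.1 X Y Z
  simpa [algQ, pV_apply, pH_apply, hX, hY, hZ] using h

omit hA in
lemma AlgReductive.vertical {X Y Z : V} (hX : F X = 0) (hY : F Y = 0) (hZ : F (F Z) = -Z) :
    A X Y Z = -A Y X Z := by
  -- With FZ as third argument, `algQ` equals -A(X, Y, F(FZ)) = A(X, Y, Z).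
  have h := hR.2 X Y (F Z)
  simp only [algQ, pV_apply, pH_apply, hX, hY, hZ, map_neg, map_zero, neg_zero, sub_zero,
    neg_neg, LinearMap.zero_apply] at h
  linarith

variable (hG : IsSkew₃ (algExt F A))
include hG

/-- Trades a derivative of F in a vertical direction for derivatives in horizontal ones. Exchanging
the last two arguments of Ñ_F at (Y, X, FZ) relates A(X, Y, Z) to four horizontal derivatives, and
reductivity identifies these in pairs. -/
lemma mixed_of_isSkew_algExt {X Y Z : V} (hX : F X = 0) (hY : F (F Y) = -Y) (hZ : F (F Z) = -Z) :
    A X Y Z = A Y Z X - A (F Y) (F Z) X := by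
  have h := (hG Y X (F Z)).2
  have r1 := hR.horizontal (X := Z) (Y := F Y) hZ (hA.cube Y) hX
  have r2 := hR.horizontal (X := F Z) (Y := Y) (hA.cube Z) hY hX
  have s1 := hA.skew (F Y) X (F Z)
  have s2 := hA.skew Y X Z
  simp only [algExt, algN, algPhi, algR, pV_apply, pH_apply, hX, hY, hZ, map_neg, map_zero,
    neg_zero, sub_zero, neg_neg, LinearMap.zero_apply, LinearMap.neg_apply, sub_self] at h r1 r2
  linarith

-- The curvatures vanish on ℋ³, so there Ñ_F reduces to N_F and type 𝒢₁ makes the N_F term skew. The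
-- other terms are cyclic sums of expressions skew in two arguments.
omit hR in
theorem isSkew_algT {α : V →ₗ[ℝ] V →ₗ[ℝ] V →ₗ[ℝ] ℝ} (hα : IsSkew₃ fun X Y Z ↦ α X Y Z) :
    IsSkew₃ (algT F A α) := by
  intro X Y Z
  have n1 := (hG (pH F X) (pH F Y) (pH F Z))
  simp only [algExt, algPhi, algR, pV_apply, pH_apply, map_neg, hA.cube, neg_neg,
    sub_self, map_zero, add_zero] at n1
  have a1 := (hα X Y Z)
  constructor
  · have s1 := hA.skew (F X) (F Y) (F Z)
    have s2 := hA.skew (F Y) (F Z) (F X)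
    have s3 := hA.skew (F Z) (F X) (F Y)
    simp only [algT, algD, algPhi, algR, pH_apply, map_neg]
    linarith [n1.1, a1.1]
  · have s1 := hA.skew (F X) (F Y) (F Z)
    have s2 := hA.skew (F Y) (F Z) (F X)
    have s3 := hA.skew (F Z) (F X) (F Y)
    simp only [algT, algD, algPhi, algR, pH_apply, map_neg]
    linarith [n1.2, a1.2]

omit hR hG in
lemma algT_vertical {α : V →ₗ[ℝ] V →ₗ[ℝ] V →ₗ[ℝ] ℝ}
    (hα : ∀ X Y Z, α (pV F X) (pV F Y) (pV F Z) = α X Y Z) (X Y Z : V) :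
    algT F A α (pV F X) (pV F Y) (pV F Z) = α X Y Z := by
  rw [algT, hα]
  simp [algD, algN, algPhi, algR, pV_apply, pH_apply, hA.cube]

/-- By linearity only purely horizontal or vertical arguments matter; for each type at most one kind
of term of `algT` survives, except that ℋ³ involves both `algD` and `algN`. -/
theorem isParallelEq_algT {α : V →ₗ[ℝ] V →ₗ[ℝ] V →ₗ[ℝ] ℝ}
    (hα : ∀ X Y Z, α (pV F X) (pV F Y) (pV F Z) = α X Y Z) :
    IsParallelEq F A (algT F A α) := by
  have α₂ : ∀ X Y Z, α X (F Y) Z = 0 := fun X Y Z ↦ by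
    rw [← hα]; simp [pV_apply, pH_apply, hA.cube]
  have α₃ : ∀ X Y Z, α X Y (F Z) = 0 := fun X Y Z ↦ by
    rw [← hα]; simp [pV_apply, pH_apply, hA.cube]
  suffices h : ∀ X Y Z,
      2 * A X Y Z + (algT F A α X (F Y) Z + algT F A α X Y (F Z)) = 0 from fun X Y Z ↦ by
    linarith [h X Y Z]
  refine eq_zero_of_horizontal_or_vertical hA.cube (fun a b v w ↦ ?_) (fun u a b w ↦ ?_)
    (fun u v a b ↦ ?_) ?_
  · simp only [algT, algD, algN, algPhi, algR, map_add, LinearMap.add_apply]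
    ring
  · simp only [algT, algD, algN, algPhi, algR, map_add, LinearMap.add_apply]
    ring
  · simp only [algT, algD, algN, algPhi, algR, map_add, LinearMap.add_apply]
    ring
  rintro X Y Z hX hY hZ
  simp only [algT, algD, algN, algPhi, algR, pV_apply, pH_apply, α₂, α₃]
  rcases hY with hY | hY <;> rcases hZ with hZ | hZ
  · have hFY : F (F (F Y)) = -F Y := hA.cube Y
    have hFZ : F (F (F Z)) = -F Z := hA.cube Z
    rcases hX with hX | hX
    -- All horizontal: this is the almost Hermitian computation, where skewness of N_F together with
    -- the rules for moving F between arguments suffices.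
    · have n := (hG X Y (F Z)).2
      simp only [algExt, algN, algPhi, algR, pV_apply, pH_apply, hX, hY, hZ, map_neg, map_zero,
        neg_zero, neg_neg, LinearMap.zero_apply, LinearMap.neg_apply, sub_self,
        add_zero] at n ⊢
      linarith [hA.skew Y Z X, hA.skew (F Y) Z (F X), hA.skew (F Y) X (F Z),
        hA.apply_comm_of_horizontal (X := F Y) hZ hX, hA.apply_comm_of_horizontal (X := F X) hY hZ,
        hA.apply_apply_of_horizontal (X := X) hY hZ, hA.apply_apply_of_horizontal (X := Y) hZ hX,
        hA.apply_apply_of_horizontal (X := Z) hX hY, hA.skew (F X) Y (F Z), hA.skew (F X) (F Y) Z,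
        hA.skew X Y Z, hA.skew X (F Y) (F Z), hA.apply_comm_of_horizontal (X := F Z) hX hY,
        hA.skew Y (F X) (F Z), hA.apply_apply_of_horizontal (X := Y) hX hZ]
    -- X vertical, Y and Z horizontal: only Φ survives in the torsion, and it involves horizontal
    -- derivatives alone.
    · have m := mixed_of_isSkew_algExt hA hR hG hX hY hZ
      have r1 := hR.horizontal (X := Z) (Y := F Y) hZ hFY hX
      have r2 := hR.horizontal (X := F Z) (Y := Y) hFZ hY hX
      simp only [hX, hY, hZ, map_neg, map_zero, neg_zero, sub_zero, neg_neg, LinearMap.zero_apply,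
        LinearMap.neg_apply, sub_self, add_zero, zero_add] at r1 r2 ⊢
      linarith
  · rcases hX with hX | hX
    · have r := hR.horizontal (X := X) (Y := F Y) hX (hA.cube Y) hZ
      simp only [hX, hY, hZ, map_neg, map_zero, neg_zero, sub_zero, neg_neg, LinearMap.zero_apply,
        LinearMap.neg_apply, sub_self, add_zero, zero_add] at r ⊢
      linarith
    -- Two vertical arguments, one of them X: only R_𝒱 survives.
    · have r := hR.vertical hX hZ hY
      simp only [hX, hY, hZ, map_neg, map_zero, neg_zero, sub_zero, neg_neg, LinearMap.zero_apply,
        sub_self, add_zero, zero_add]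
      linarith [hA.skew X Y Z]
  · rcases hX with hX | hX
    · have r := hR.horizontal (X := X) (Y := F Z) hX (hA.cube Z) hY
      simp only [hX, hY, hZ, map_neg, map_zero, neg_zero, sub_zero, neg_neg, LinearMap.zero_apply,
        LinearMap.neg_apply, sub_self, add_zero, zero_add] at r ⊢
      linarith [hA.skew X Y Z]
    · have r := hR.vertical hX hY hZ
      simp only [hX, hY, hZ, map_neg, map_zero, neg_zero, sub_zero, neg_neg, LinearMap.zero_apply,
        sub_self, add_zero, zero_add]
      linarith
  · simp [hY, hZ, hA.eq_zero_of_vertical hY hZ]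

end Sufficiency

end Algebra

/-! ### Smoothness of vector fields -/

section Smooth

variable {E : Type*} [NormedAddCommGroup E] [NormedSpace ℝ E]
  {N : Type*} [TopologicalSpace N] [ChartedSpace E N] [IsManifold 𝓘(ℝ, E) ∞ N]

lemma SmoothAt.diffAt {X : VField E N} {x : N} (hX : SmoothAt X x) : DiffAt X x :=
  ContMDiffAt.mdifferentiableAt hX (by simp)

/-- Being C¹ at a point is an open condition, hence the passage from ∞ to 1. The Koszul formula for
D needs differentiable fields at every nearby point before it can yield smoothness. -/
lemma SmoothAt.eventually_diffAt {X : VField E N} {x : N} (hX : SmoothAt X x) :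
    ∀ᶠ y in 𝓝 x, DiffAt X y := by
  have h1 : ContMDiffAt 𝓘(ℝ, E) 𝓘(ℝ, E).tangent 1
      (fun y ↦ (⟨y, X y⟩ : TangentBundle 𝓘(ℝ, E) N)) x := ContMDiffAt.of_le hX (by simp)
  filter_upwards [(contMDiffAt_iff_contMDiffAt_nhds (by simp)).1 h1] with y hy
  exact hy.mdifferentiableAt (by simp)

lemma EndField.IsSmooth.smoothAt_app {A : EndField E N} (hA : A.IsSmooth) {X : VField E N} {x : N}
    (hX : SmoothAt X x) : SmoothAt (A.app X) x :=
  ContMDiffAt.clm_bundle_apply (F₁ := E) (F₂ := E) hA.contMDiffAt hX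

lemma EndField.IsSmooth.diffAt_app {A : EndField E N} (hA : A.IsSmooth) {X : VField E N} {x : N}
    (hX : DiffAt X x) : DiffAt (A.app X) x :=
  MDifferentiableAt.clm_bundle_apply (F₁ := E) (F₂ := E)
    (hA.contMDiffAt.mdifferentiableAt (by simp)) hX

omit [IsManifold 𝓘(ℝ, E) ∞ N] in
lemma projH_app (F : EndField E N) (X : VField E N) :
    (projH F).app X = -F.app (F.app X) := rfl

omit [IsManifold 𝓘(ℝ, E) ∞ N] in
lemma projV_app (F : EndField E N) (X : VField E N) :
    (projV F).app X = X + F.app (F.app X) := by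
  funext x
  simp [EndField.app, projV, projH]

variable (h : Metric E N)

lemma contMDiffAt_ip {X Y : VField E N} {x : N} (hX : SmoothAt X x) (hY : SmoothAt Y x) :
    ContMDiffAt 𝓘(ℝ, E) 𝓘(ℝ, ℝ) ∞ (ip h X Y) x := by
  have h2 : ContMDiffAt 𝓘(ℝ, E) (𝓘(ℝ, E).prod 𝓘(ℝ, ℝ)) ∞
      (fun m ↦ Bundle.TotalSpace.mk' ℝ (E := Bundle.Trivial N ℝ) m (h.inner m (X m) (Y m))) x :=
    ContMDiffAt.clm_bundle_apply (F₁ := E) (F₂ := ℝ)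
      (ContMDiffAt.clm_bundle_apply (F₁ := E) (F₂ := E →L[ℝ] ℝ) h.contMDiff.contMDiffAt hX) hY
  simp only [Bundle.contMDiffAt_totalSpace] at h2
  exact h2.2

lemma contMDiffAt_lieFun {X : VField E N} {f : N → ℝ} {x : N} (hX : SmoothAt X x)
    (hf : ContMDiffAt 𝓘(ℝ, E) 𝓘(ℝ, ℝ) ∞ f x) :
    ContMDiffAt 𝓘(ℝ, E) 𝓘(ℝ, ℝ) ∞ (lieFun X f) x := by
  have h1 := hf.mfderiv_const (m := ∞) (by simp)
  have h2 := ContMDiffAt.clm_apply_of_inCoordinates (F₁ := E) (F₂ := ℝ)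
    (E₁ := fun x : N ↦ TangentSpace 𝓘(ℝ, E) x) (E₂ := fun y : ℝ ↦ TangentSpace 𝓘(ℝ, ℝ) y)
    (b₁ := id) (b₂ := f) h1 hX hf
  simp only [Bundle.contMDiffAt_totalSpace] at h2
  refine h2.2.congr_of_eventuallyEq (Filter.Eventually.of_forall fun y ↦ ?_)
  simp [lieFun, mvfderiv]
  rfl

lemma smoothAt_add {X Y : VField E N} {x : N} (hX : SmoothAt X x) (hY : SmoothAt Y x) :
    SmoothAt (X + Y) x :=
  ContMDiffAt.add_section hX hY

lemma smoothAt_neg {X : VField E N} {x : N} (hX : SmoothAt X x) :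
    SmoothAt (-X) x :=
  ContMDiffAt.neg_section hX

lemma EndField.IsSmooth.smoothAt_projH {F : EndField E N} (hF : F.IsSmooth) {X : VField E N} {x : N}
    (hX : SmoothAt X x) : SmoothAt ((projH F).app X) x :=
  smoothAt_neg (hF.smoothAt_app (hF.smoothAt_app hX))

lemma EndField.IsSmooth.smoothAt_projV {F : EndField E N} (hF : F.IsSmooth) {X : VField E N} {x : N}
    (hX : SmoothAt X x) : SmoothAt ((projV F).app X) x :=
  projV_app F X ▸ smoothAt_add hX (hF.smoothAt_app (hF.smoothAt_app hX))

lemma EndField.IsSmooth.diffAt_projH {F : EndField E N} (hF : F.IsSmooth) {X : VField E N} {x : N}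
    (hX : DiffAt X x) : DiffAt ((projH F).app X) x :=
  mdifferentiableAt_neg_section (hF.diffAt_app (hF.diffAt_app hX))

lemma EndField.IsSmooth.diffAt_projV {F : EndField E N} (hF : F.IsSmooth) {X : VField E N} {x : N}
    (hX : DiffAt X x) : DiffAt ((projV F).app X) x :=
  projV_app F X ▸ mdifferentiableAt_add_section hX (hF.diffAt_app (hF.diffAt_app hX))

variable [FiniteDimensional ℝ E]

lemma smoothAt_bracket {X Y : VField E N} {x : N} (hX : SmoothAt X x) (hY : SmoothAt Y x) :
    SmoothAt (bracket X Y) x :=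
  haveI : IsManifold 𝓘(ℝ, E) (minSmoothness ℝ 2) N := by
    rw [minSmoothness_of_isRCLikeNormedField]; infer_instance
  haveI : IsManifold 𝓘(ℝ, E) (((⊤ : ℕ∞) : ℕ∞ω) + 1) N :=
    inferInstanceAs (IsManifold 𝓘(ℝ, E) ∞ N)
  ContMDiffAt.mlieBracket_vectorField (m := ⊤) (n := ⊤) hX hY (by simp)

lemma contMDiffAt_koszul {X Y Z : VField E N} {x : N} (hX : SmoothAt X x) (hY : SmoothAt Y x)
    (hZ : SmoothAt Z x) : ContMDiffAt 𝓘(ℝ, E) 𝓘(ℝ, ℝ) ∞ (koszul h X Y Z) x := by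
  have h1 := contMDiffAt_lieFun hX (contMDiffAt_ip h hY hZ)
  have h2 := contMDiffAt_lieFun hY (contMDiffAt_ip h hX hZ)
  have h3 := contMDiffAt_lieFun hZ (contMDiffAt_ip h hX hY)
  have h4 := contMDiffAt_ip h (smoothAt_bracket hX hY) hZ
  have h5 := contMDiffAt_ip h (smoothAt_bracket hX hZ) hY
  have h6 := contMDiffAt_ip h (smoothAt_bracket hY hZ) hX
  exact ((((h1.add h2).sub h3).add h4).sub h5).sub h6

omit [IsManifold 𝓘(ℝ, E) ∞ N] in
/-- A family of linear maps is smooth as soon as its values on fixed vectors are. -/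
lemma contMDiffAt_clm_of_apply {G : Type*} [NormedAddCommGroup G] [NormedSpace ℝ G]
    {f : N → E →L[ℝ] G} {x : N}
    (hf : ∀ e, ContMDiffAt 𝓘(ℝ, E) 𝓘(ℝ, G) ∞ (fun y ↦ f y e) x) :
    ContMDiffAt 𝓘(ℝ, E) 𝓘(ℝ, E →L[ℝ] G) ∞ f x := by
  let b := Module.finBasis ℝ E
  have key : f = fun y ↦ ∑ i, ContinuousLinearMap.smulRightL ℝ E G
      (LinearMap.toContinuousLinearMap (b.coord i)) (f y (b i)) := by
    funext y
    ext e
    conv_lhs => rw [← b.sum_repr e, map_sum]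
    simp
  rw [key]
  refine contMDiffAt_finsetSum fun i _ ↦ ?_
  exact (ContinuousLinearMap.contMDiff _).contMDiffAt.comp x (hf (b i))

/-- A vector field is smooth as soon as its inner products with smooth vector fields are. -/
lemma smoothAt_of_ip {S : VField E N} {x : N}
    (hS : ∀ Z : VField E N, SmoothAt Z x → ContMDiffAt 𝓘(ℝ, E) 𝓘(ℝ, ℝ) ∞ (ip h S Z) x) :
    SmoothAt S x := by
  let t := trivializationAt E (fun x : N ↦ TangentSpace 𝓘(ℝ, E) x) x
  have hx : x ∈ t.baseSet := FiberBundle.mem_baseSet_trivializationAt' x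
  have hframe : ∀ e : E, SmoothAt (fun y ↦ t.symmL ℝ y e : VField E N) x := fun e ↦ by
    refine (t.contMDiffAt_section_iff hx).2 ?_
    refine (contMDiffAt_const (c := e)).congr_of_eventuallyEq ?_
    filter_upwards [t.open_baseSet.mem_nhds hx] with y hy
    simp [hy]
  -- The Gram form of the metric in the local frame. The coordinates of `S` are recovered by
  -- applying its inverse to the inner products of `S` with the frame.
  let g : N → E →L[ℝ] E →L[ℝ] ℝ := fun y ↦
    LinearMap.toContinuousLinearMap
      { toFun := fun e ↦ (h.inner y (t.symmL ℝ y e)) ∘L (t.symmL ℝ y)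
        map_add' := fun a b ↦ by ext; simp
        map_smul' := fun c a ↦ by ext; simp }
  have hg : ContMDiffAt 𝓘(ℝ, E) 𝓘(ℝ, E →L[ℝ] E →L[ℝ] ℝ) ∞ g x :=
    contMDiffAt_clm_of_apply fun e ↦ contMDiffAt_clm_of_apply fun e' ↦
      contMDiffAt_ip h (hframe e) (hframe e')
  let σ : N → E := fun y ↦ t.continuousLinearMapAt ℝ y (S y)
  have hσ : ∀ y ∈ t.baseSet, t.symmL ℝ y (σ y) = S y := fun y hy ↦
    t.symmL_continuousLinearMapAt hy (S y)
  have hl : ContMDiffAt 𝓘(ℝ, E) 𝓘(ℝ, E →L[ℝ] ℝ) ∞ (fun y ↦ g y (σ y)) x := by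
    refine contMDiffAt_clm_of_apply fun e ↦ (hS _ (hframe e)).congr_of_eventuallyEq ?_
    filter_upwards [t.open_baseSet.mem_nhds hx] with y hy
    change h.inner y (t.symmL ℝ y (σ y)) (t.symmL ℝ y e) = h.inner y (S y) (t.symmL ℝ y e)
    rw [hσ y hy]
  -- `ContinuousLinearMap.inverse` is 0 on non-invertible maps, so invertibility is needed on the
  -- whole base set: positivity gives injectivity, and dimensions agree.
  have hinv : ∀ y ∈ t.baseSet, ∃ G : E ≃L[ℝ] (E →L[ℝ] ℝ), (G : E →L[ℝ] (E →L[ℝ] ℝ)) = g y := by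
    intro y hy
    have hinj : Function.Injective (g y) := by
      refine (injective_iff_map_eq_zero _).2 fun e he ↦ ?_
      have h0 : t.symmL ℝ y e = 0 := by
        by_contra hne
        have h1 : h.inner y (t.symmL ℝ y e) (t.symmL ℝ y e) = 0 := congr($he e)
        exact (h.pos y _ hne).ne' h1
      rw [← t.continuousLinearMapAt_symmL (R := ℝ) hy e, h0, map_zero]
    refine ⟨(LinearEquiv.ofInjectiveOfFinrankEq (g y).toLinearMap hinj
      ((Subspace.dual_finrank_eq (K := ℝ) (V := E)).symm.trans
        (LinearMap.toContinuousLinearMap (𝕜 := ℝ) (E := E)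
          (F' := ℝ)).finrank_eq)).toContinuousLinearEquiv, ?_⟩
    ext; rfl
  refine (t.contMDiffAt_section_iff hx).2 ?_
  have hi : ContMDiffAt 𝓘(ℝ, E) 𝓘(ℝ, (E →L[ℝ] ℝ) →L[ℝ] E) ∞
      (fun y ↦ ContinuousLinearMap.inverse (g y)) x := by
    obtain ⟨G, hG⟩ := hinv x hx
    have := contDiffAt_map_inverse (n := ∞) G
    rw [hG] at this
    exact this.contMDiffAt.comp x hg
  refine (hi.clm_apply hl).congr_of_eventuallyEq ?_
  filter_upwards [t.open_baseSet.mem_nhds hx] with y hy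
  obtain ⟨G, hG⟩ := hinv y hy
  rw [← hG]
  simp [σ, t.coe_linearMapAt_of_mem (R := ℝ) hy]

/-- A field of endomorphisms is smooth as soon as its values on smooth vector fields are. -/
lemma contMDiffAt_endField_of_app {A : EndField E N} {x : N}
    (hA : ∀ X : VField E N, SmoothAt X x → SmoothAt (A.app X) x) :
    ContMDiffAt 𝓘(ℝ, E) (𝓘(ℝ, E).prod 𝓘(ℝ, E →L[ℝ] E)) ∞
      (fun x ↦ Bundle.TotalSpace.mk' (E →L[ℝ] E)
        (E := fun x : N ↦ TangentSpace 𝓘(ℝ, E) x →L[ℝ] TangentSpace 𝓘(ℝ, E) x) x (A x)) x := by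
  let t := trivializationAt E (fun x : N ↦ TangentSpace 𝓘(ℝ, E) x) x
  have hx : x ∈ t.baseSet := FiberBundle.mem_baseSet_trivializationAt' x
  rw [contMDiffAt_hom_bundle]
  refine ⟨contMDiffAt_id, contMDiffAt_clm_of_apply fun e ↦ ?_⟩
  have hframe : SmoothAt (fun y ↦ t.symmL ℝ y e : VField E N) x := by
    refine (t.contMDiffAt_section_iff hx).2 ?_
    refine (contMDiffAt_const (c := e)).congr_of_eventuallyEq ?_
    filter_upwards [t.open_baseSet.mem_nhds hx] with y hy
    simp [hy]
  refine ((t.contMDiffAt_section_iff hx).1 (hA _ hframe)).congr_of_eventuallyEq ?_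
  filter_upwards [t.open_baseSet.mem_nhds hx] with y hy
  exact congrFun (t.coe_linearMapAt_of_mem (R := ℝ) hy) _

end Smooth

/-! ### The tensor DF of the Levi-Civita connection, and the structure tensors in terms of it. -/

section Tensors

variable {E : Type*} [NormedAddCommGroup E] [NormedSpace ℝ E]
  {N : Type*} [TopologicalSpace N] [ChartedSpace E N] [IsManifold 𝓘(ℝ, E) ∞ N]

/-- The bridge between identities tested on differentiable fields and identities between tensors at
a point. -/
lemma exists_diffAt_eq {x : N} (u : TangentSpace 𝓘(ℝ, E) x) :
    ∃ U : VField E N, DiffAt U x ∧ U x = u :=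
  ⟨FiberBundle.extend E u, FiberBundle.mdifferentiableAt_extend .., by simp⟩

/-- The linear map underlying a field of endomorphisms at a point. -/
abbrev EndField.lin (F : EndField E N) (x : N) :
    TangentSpace 𝓘(ℝ, E) x →ₗ[ℝ] TangentSpace 𝓘(ℝ, E) x := (F x).toLinearMap

lemma update_zero_of_three {V : Type*} (a b c z : V) :
    Function.update ![a, b, c] 0 z = ![z, b, c] := by
  funext i; fin_cases i <;> rfl

lemma update_one_of_three {V : Type*} (a b c z : V) :
    Function.update ![a, b, c] 1 z = ![a, z, c] := by
  funext i; fin_cases i <;> rfl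

lemma update_two_of_three {V : Type*} (a b c z : V) :
    Function.update ![a, b, c] 2 z = ![a, b, z] := by
  funext i; fin_cases i <;> rfl

/-- The trilinear map underlying an alternating form. -/
def VerticalThreeForm.lin {F : EndField E N} (α : VerticalThreeForm F) (x : N) :
    TangentSpace 𝓘(ℝ, E) x →ₗ[ℝ] TangentSpace 𝓘(ℝ, E) x →ₗ[ℝ] TangentSpace 𝓘(ℝ, E) x →ₗ[ℝ] ℝ :=
  trilinearMk (fun u v w ↦ α.toFun x ![u, v, w])
    (fun a b v w ↦ by
      simpa only [update_zero_of_three] using (α.toFun x).map_update_add ![a, v, w] 0 a b)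
    (fun c a v w ↦ by
      simpa only [update_zero_of_three, smul_eq_mul] using (α.toFun x).map_update_smul ![a, v, w] 0 c a)
    (fun u a b w ↦ by
      simpa only [update_one_of_three] using (α.toFun x).map_update_add ![u, a, w] 1 a b)
    (fun c u a w ↦ by
      simpa only [update_one_of_three, smul_eq_mul] using (α.toFun x).map_update_smul ![u, a, w] 1 c a)
    (fun u v a b ↦ by
      simpa only [update_two_of_three] using (α.toFun x).map_update_add ![u, v, a] 2 a b)
    (fun c u v a ↦ by
      simpa only [update_two_of_three, smul_eq_mul] using (α.toFun x).map_update_smul ![u, v, a] 2 c a)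

lemma VerticalThreeForm.lin_apply {F : EndField E N} (α : VerticalThreeForm F) {x : N}
    (u v w : TangentSpace 𝓘(ℝ, E) x) : α.lin x u v w = α.toFun x ![u, v, w] := rfl

lemma VerticalThreeForm.isSkew_lin {F : EndField E N} (α : VerticalThreeForm F) (x : N) :
    IsSkew₃ (fun u v w ↦ α.lin x u v w) := by
  intro u v w
  simp only [VerticalThreeForm.lin_apply]
  constructor
  · have h := (α.toFun x).toAlternatingMap.map_swap ![v, u, w] (i := 0) (j := 1) (by decide)
    have e : (![v, u, w] ∘ Equiv.swap (0 : Fin 3) 1) = ![u, v, w] := by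
      funext i; fin_cases i <;> rfl
    rw [e] at h
    exact h
  · have h := (α.toFun x).toAlternatingMap.map_swap ![u, w, v] (i := 1) (j := 2) (by decide)
    have e : (![u, w, v] ∘ Equiv.swap (1 : Fin 3) 2) = ![u, v, w] := by
      funext i; fin_cases i <;> rfl
    rw [e] at h
    exact h

lemma VerticalThreeForm.lin_vertical {F : EndField E N} (α : VerticalThreeForm F) {x : N}
    (u v w : TangentSpace 𝓘(ℝ, E) x) :
    α.lin x (pV (F.lin x) u) (pV (F.lin x) v) (pV (F.lin x) w) = α.lin x u v w :=
  (α.vertical x u v w).symm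

variable {h : Metric E N} {F : EndField E N} (hF : IsRiemannianFStructure h F)

lemma IsRiemannianFStructure.cube_eq (hF : IsRiemannianFStructure h F) {x : N}
    (u : TangentSpace 𝓘(ℝ, E) x) : F x (F x (F x u)) = -F x u :=
  eq_neg_of_add_eq_zero_left (hF.cube x u)

/-- As v + F²v is vertical, orthogonality gives ⟨Fu, v⟩ = -⟨Fu, F²v⟩. The isometry property with F³
= -F turns this into ⟨F²u, Fv⟩, and orthogonality for u + F²u into -⟨u, Fv⟩. -/
lemma IsRiemannianFStructure.inner_app (hF : IsRiemannianFStructure h F) {x : N}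
    (u v : TangentSpace 𝓘(ℝ, E) x) : h.inner x (F x u) v = -h.inner x u (F x v) := by
  have h1 := hF.orthogonal x u (v + F x (F x v)) (by rw [map_add, hF.cube_eq, add_neg_cancel])
  have h2 := hF.orthogonal x v (u + F x (F x u)) (by rw [map_add, hF.cube_eq, add_neg_cancel])
  have h3 := hF.isometry x u (F x v)
  rw [h.symm] at h2
  simp only [hF.cube_eq, map_add, map_neg, add_apply] at h1 h2 h3
  linarith

variable [FiniteDimensional ℝ E]

lemma bracket_eq {X Y : VField E N} {x : N} (hX : DiffAt X x) (hY : DiffAt Y x) :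
    bracket X Y x = leviCivita h Y x (X x) - leviCivita h X x (Y x) := by
  have h1 := (leviCivita h).torsion_apply hX hY
  rw [leviCivita_torsion h x] at h1
  exact (sub_eq_zero.1 h1.symm).symm

lemma lieFun_ip {X Y Z : VField E N} {x : N} (hX : DiffAt X x) (hY : DiffAt Y x) :
    lieFun Z (ip h X Y) x
      = h.inner x (leviCivita h X x (Z x)) (Y x) + h.inner x (X x) (leviCivita h Y x (Z x)) :=
  leviCivita_metric h x X Y (Z x) hX hY

/-- The tensor `(X, Y) ↦ (D_X F) Y`, for the Levi-Civita connection `D`. -/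
def nablaF (hF : IsRiemannianFStructure h F) (x : N) :
    TangentSpace 𝓘(ℝ, E) x →L[ℝ] TangentSpace 𝓘(ℝ, E) x →L[ℝ] TangentSpace 𝓘(ℝ, E) x :=
  TensorialAt.mkHom₂ (I := 𝓘(ℝ, E)) (F := E) (F' := E)
    (V := fun x : N ↦ TangentSpace 𝓘(ℝ, E) x) (V' := fun x : N ↦ TangentSpace 𝓘(ℝ, E) x)
    (fun X Y ↦ leviCivita h (F.app Y) x (X x) - F x (leviCivita h Y x (X x))) x
    (fun Y _ ↦
      ⟨fun {f X} _ _ ↦ by simp [smul_sub], fun {X X'} _ _ ↦ by simp; abel⟩)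
    (fun X _ ↦
      ⟨fun {f Y} hf hY ↦ by
        have e : F.app (f • Y) = f • F.app Y := by funext y; simp [EndField.app]
        simp only [e, (leviCivita h).isCovariantDerivativeOnUniv.leibniz hY hf,
          (leviCivita h).isCovariantDerivativeOnUniv.leibniz (hF.smooth.diffAt_app hY) hf]
        simp [EndField.app, smul_sub],
      fun {Y Y'} hY hY' ↦ by
        have e : F.app (Y + Y') = F.app Y + F.app Y' := by funext y; simp [EndField.app]
        simp only [e, (leviCivita h).isCovariantDerivativeOnUniv.add hY hY',
          (leviCivita h).isCovariantDerivativeOnUniv.add (hF.smooth.diffAt_app hY)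
            (hF.smooth.diffAt_app hY')]
        simp
        abel⟩)

/-- The trilinear form `(X, Y, Z) ↦ ⟨(D_X F) Y, Z⟩`. -/
def derivF (hF : IsRiemannianFStructure h F) (x : N) :
    TangentSpace 𝓘(ℝ, E) x →ₗ[ℝ] TangentSpace 𝓘(ℝ, E) x →ₗ[ℝ] TangentSpace 𝓘(ℝ, E) x →ₗ[ℝ] ℝ :=
  trilinearMk (fun u v w ↦ h.inner x (nablaF hF x u v) w)
    (by simp) (by simp) (by simp) (by simp) (by simp) (by simp)

lemma derivF_apply {X Y : VField E N} {x : N} (hX : DiffAt X x) (hY : DiffAt Y x)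
    (w : TangentSpace 𝓘(ℝ, E) x) :
    derivF hF x (X x) (Y x) w
      = h.inner x (leviCivita h (F.app Y) x (X x)) w
        + h.inner x (leviCivita h Y x (X x)) (F x w) := by
  have e : nablaF hF x (X x) (Y x)
      = leviCivita h (F.app Y) x (X x) - F x (leviCivita h Y x (X x)) :=
    TensorialAt.mkHom₂_apply _ _ hX hY
  change h.inner x (nablaF hF x (X x) (Y x)) w = _
  rw [e, map_sub, sub_apply, hF.inner_app]
  ring

lemma derivF_eq_koszul {X Y Z : VField E N} {x : N} (hX : DiffAt X x) (hY : DiffAt Y x)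
    (hZ : DiffAt Z x) :
    derivF hF x (X x) (Y x) (Z x)
      = 1 / 2 * koszul h X (F.app Y) Z x + 1 / 2 * koszul h X Y (F.app Z) x := by
  rw [derivF_apply hF hX hY, inner_leviCivita h hX (hF.smooth.diffAt_app hY) hZ,
    ← inner_leviCivita h hX hY (hF.smooth.diffAt_app hZ)]
  rfl

/-- `skew` is the derivative of ⟨FY, Z⟩ = -⟨Y, FZ⟩, as D is metric. `deriv` is the derivative of F³
+ F = 0, each F on the left being moved to Z with a sign. -/
lemma isDerivOfF_derivF (x : N) : IsDerivOfF (F.lin x) (derivF hF x) where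
  cube := hF.cube_eq
  skew u v w := by
    obtain ⟨X, hX, rfl⟩ := exists_diffAt_eq u
    obtain ⟨Y, hY, rfl⟩ := exists_diffAt_eq v
    obtain ⟨Z, hZ, rfl⟩ := exists_diffAt_eq w
    have h1 := lieFun_ip (h := h) (Z := X) (hF.smooth.diffAt_app hY) hZ
    have h2 := lieFun_ip (h := h) (Z := X) hY (hF.smooth.diffAt_app hZ)
    have e : ip h (F.app Y) Z = -ip h Y (F.app Z) := by
      funext y; exact hF.inner_app _ _
    have h3 : lieFun X (ip h (F.app Y) Z) x = -lieFun X (ip h Y (F.app Z)) x := by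
      rw [e]
      have h0 := lieFun_add X (ip_mdiffAt h hY (hF.smooth.diffAt_app hZ))
        (ip_mdiffAt h hY (hF.smooth.diffAt_app hZ)).neg
      rw [add_neg_cancel] at h0
      have hz : lieFun X (0 : N → ℝ) x = 0 := by
        have := lieFun_add X (f := (0 : N → ℝ)) (g := 0) (x := x) mdifferentiableAt_const
          mdifferentiableAt_const
        simpa using this
      linarith
    rw [derivF_apply hF hX hY, derivF_apply hF hX hZ, h.symm x _ (Y x), h.symm x _ (F x (Y x))]
    simp only [EndField.app] at h1 h2
    linarith
  deriv u v w := by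
    obtain ⟨X, hX, rfl⟩ := exists_diffAt_eq u
    obtain ⟨Y, hY, rfl⟩ := exists_diffAt_eq v
    have hY1 := hF.smooth.diffAt_app hY
    have hY2 := hF.smooth.diffAt_app hY1
    have e : F.app (F.app (F.app Y)) = (-1 : ℝ) • F.app Y := by
      funext y; simpa [EndField.app] using hF.cube_eq (Y y)
    have e2 : leviCivita h (F.app (F.app (F.app Y))) x = -leviCivita h (F.app Y) x := by
      rw [e, (leviCivita h).isCovariantDerivativeOnUniv.smul_const _ hY1, neg_one_smul]
    have a1 := derivF_apply hF hX hY2 w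
    have a2 := derivF_apply hF hX hY1 (F x w)
    have a3 := derivF_apply hF hX hY (F x (F x w))
    have a4 := derivF_apply hF hX hY w
    rw [e2] at a1
    rw [hF.cube_eq] at a3
    simp only [EndField.app, map_neg, neg_apply] at a1 a2 a3 a4
    change derivF hF x (X x) (F x (F x (Y x))) w - derivF hF x (X x) (F x (Y x)) (F x w)
      + derivF hF x (X x) (Y x) (F x (F x w)) + derivF hF x (X x) (Y x) w = 0
    rw [a1, a2, a3, a4]
    ring

/-- For a torsion-free metric connection, dΩ_F is the cyclic sum of DΩ_F, and DΩ_F is `derivF`. -/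
lemma dcFundForm_eq {X Y Z : VField E N} {x : N} (hX : DiffAt X x) (hY : DiffAt Y x)
    (hZ : DiffAt Z x) :
    dcFundForm h F X Y Z x
      = -algD (derivF hF x) (F x (X x)) (F x (Y x)) (F x (Z x)) := by
  have key : ∀ X Y Z : VField E N, DiffAt X x → DiffAt Y x → DiffAt Z x →
      extDeriv₂ (fundForm h F) X Y Z x = algD (derivF hF x) (X x) (Y x) (Z x) := by
    intro X Y Z hX hY hZ
    have hFX := hF.smooth.diffAt_app hX
    have hFY := hF.smooth.diffAt_app hY
    have hFZ := hF.smooth.diffAt_app hZ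
    simp only [extDeriv₂, algD, fundForm, derivF_apply hF hX hY, derivF_apply hF hY hZ,
      derivF_apply hF hZ hX, lieFun_ip hFX hY, lieFun_ip hFY hZ, lieFun_ip hFZ hX]
    simp only [ip, EndField.app, bracket_eq (h := h) hX hY, bracket_eq (h := h) hY hZ,
      bracket_eq (h := h) hZ hX, map_sub, sub_apply, hF.inner_app (leviCivita h _ x _)]
    rw [h.symm x (F x (X x)), h.symm x (F x (Y x)), h.symm x (F x (Z x))]
    ring
  rw [dcFundForm, TriForm.comp, key _ _ _ (hF.smooth.diffAt_app hX) (hF.smooth.diffAt_app hY)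
    (hF.smooth.diffAt_app hZ)]
  rfl

lemma nijenhuis_eq {X Y Z : VField E N} {x : N} (hX : DiffAt X x) (hY : DiffAt Y x) :
    nijenhuis h F X Y Z x = algN (F.lin x) (derivF hF x) (X x) (Y x) (Z x) := by
  have hFX := hF.smooth.diffAt_app hX
  have hFY := hF.smooth.diffAt_app hY
  have a1 := derivF_apply hF hFX hY (Z x)
  have a2 := derivF_apply hF hFY hX (Z x)
  have a3 := derivF_apply hF hX hY (F x (Z x))
  have a4 := derivF_apply hF hY hX (F x (Z x))
  simp only [EndField.app] at a1 a2
  change _ = derivF hF x (F x (X x)) (Y x) (Z x) - derivF hF x (F x (Y x)) (X x) (Z x)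
    + derivF hF x (X x) (Y x) (F x (Z x)) - derivF hF x (Y x) (X x) (F x (Z x))
  rw [a1, a2, a3, a4]
  simp only [nijenhuis, ip, Pi.sub_apply, map_sub, sub_apply]
  simp only [EndField.app, projH, neg_apply, ContinuousLinearMap.comp_apply, map_neg]
  rw [bracket_eq (h := h) hFX hFY, bracket_eq (h := h) hFX hY, bracket_eq (h := h) hX hFY,
    bracket_eq (h := h) hX hY]
  simp only [hF.inner_app, map_sub, sub_apply, EndField.app]
  ring

include hF in
lemma leviCivita_projV {Y : VField E N} {x : N} (hY : DiffAt Y x) :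
    leviCivita h ((projV F).app Y) x
      = leviCivita h Y x + leviCivita h (F.app (F.app Y)) x := by
  rw [projV_app]
  exact (leviCivita h).isCovariantDerivativeOnUniv.add hY
    (hF.smooth.diffAt_app (hF.smooth.diffAt_app hY))

include hF in
lemma leviCivita_projH {Y : VField E N} {x : N} (hY : DiffAt Y x) :
    leviCivita h ((projH F).app Y) x = -leviCivita h (F.app (F.app Y)) x := by
  have e : (projH F).app Y = (-1 : ℝ) • F.app (F.app Y) := by
    rw [projH_app, neg_one_smul]
  rw [e, (leviCivita h).isCovariantDerivativeOnUniv.smul_const _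
    (hF.smooth.diffAt_app (hF.smooth.diffAt_app hY)), neg_one_smul]

lemma derivProjV_eq {X Y Z : VField E N} {x : N} (hX : DiffAt X x) (hY : DiffAt Y x) :
    derivProjV h F X Y Z x = algQ (F.lin x) (derivF hF x) (X x) (Y x) (Z x) := by
  have a1 := derivF_apply hF hX (hF.smooth.diffAt_app hY) (Z x)
  have a2 := derivF_apply hF hX hY (F x (Z x))
  change _ = derivF hF x (X x) (F x (Y x)) (Z x) - derivF hF x (X x) (Y x) (F x (Z x))
  simp only [EndField.app] at a1 a2
  rw [a1, a2, derivProjV, leviCivita_projV hF hY]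
  simp only [projV, projH, map_sub, sub_apply, add_apply, map_add,
    ContinuousLinearMap.id_apply, neg_apply, map_neg, ContinuousLinearMap.comp_apply, hF.inner_app]
  ring

/-- The argument FY makes (D_{PX} F)(FY) contain D_{PX}(F²Y) = -D_{PX}(PY), and pairing with qZ
kills the other term because Fq = 0. -/
lemma curvH_eq {X Y Z : VField E N} {x : N} (hX : DiffAt X x) (hY : DiffAt Y x) :
    curvH h F X Y Z x = algPhi (F.lin x) (derivF hF x) (X x) (Y x) (Z x) := by
  have hFX := hF.smooth.diffAt_app hX
  have hFY := hF.smooth.diffAt_app hY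
  have hPX := hF.smooth.diffAt_projH hX
  have hPY := hF.smooth.diffAt_projH hY
  have a1 := derivF_apply hF hPX hFY (projV F x (Z x))
  have a2 := derivF_apply hF hPY hFX (projV F x (Z x))
  have e0 : F x (projV F x (Z x)) = 0 := by
    simp [projV, projH, hF.cube_eq]
  change _ = derivF hF x ((projH F).app X x) (F.app Y x) (projV F x (Z x))
    - derivF hF x ((projH F).app Y x) (F.app X x) (projV F x (Z x))
  have e1 : ∀ u v, h.inner x (projV F x u) v = h.inner x u (projV F x v) := by
    intro u v
    simp [projV, projH, hF.inner_app]
  rw [a1, a2, e0]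
  change h.inner x (-(projV F x (bracket ((projH F).app X) ((projH F).app Y) x))) (Z x) = _
  rw [map_neg, neg_apply, e1, bracket_eq (h := h) hPX hPY, leviCivita_projH hF hX,
    leviCivita_projH hF hY]
  simp only [map_sub, sub_apply, neg_apply, map_neg, map_zero]
  ring

/-- Since F(qY) = 0 as a field, (D_{qX} F)(qY) = -F D_{qX}(qY); pairing with FZ produces the
projector P. -/
lemma curvV_eq {X Y Z : VField E N} {x : N} (hX : DiffAt X x) (hY : DiffAt Y x) :
    curvV h F X Y Z x = algR (F.lin x) (derivF hF x) (X x) (Y x) (Z x) := by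
  have hPX := hF.smooth.diffAt_projV hX
  have hPY := hF.smooth.diffAt_projV hY
  have a1 := derivF_apply hF hPX hPY (F x (Z x))
  have a2 := derivF_apply hF hPY hPX (F x (Z x))
  have e0 : ∀ Y : VField E N, F.app ((projV F).app Y) = 0 := by
    intro Y
    funext y
    simp [EndField.app, projV, projH, hF.cube_eq]
  change _ = derivF hF x ((projV F).app X x) ((projV F).app Y x) (F x (Z x))
    - derivF hF x ((projV F).app Y x) ((projV F).app X x) (F x (Z x))
  have e1 : ∀ u v, h.inner x (projH F x u) v = -h.inner x u (F x (F x v)) := by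
    intro u v
    simp [projH, hF.inner_app]
  rw [a1, a2, e0, e0]
  change h.inner x (-(projH F x (bracket ((projV F).app X) ((projV F).app Y) x))) (Z x) = _
  rw [map_neg, neg_apply, e1, bracket_eq (h := h) hPX hPY]
  simp

end Tensors

/-! ### Metric connections with skew torsion, written as D + T/2. -/

section MetricConnections

variable {E : Type*} [NormedAddCommGroup E] [NormedSpace ℝ E] [FiniteDimensional ℝ E]
  {N : Type*} [TopologicalSpace N] [ChartedSpace E N] [IsManifold 𝓘(ℝ, E) ∞ N]

variable {h : Metric E N} {F : EndField E N}

/-- The torsion of a connection at a point, as a trilinear map. -/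
def torsionLin (h : Metric E N) (cov : Connection E N) (x : N) :
    TangentSpace 𝓘(ℝ, E) x →ₗ[ℝ] TangentSpace 𝓘(ℝ, E) x →ₗ[ℝ] TangentSpace 𝓘(ℝ, E) x →ₗ[ℝ] ℝ :=
  trilinearMk (fun u v w ↦ h.inner x (cov.torsion x u v) w)
    (by simp) (by simp) (by simp) (by simp) (by simp) (by simp)

lemma torsionLin_apply (cov : Connection E N) (X Y Z : VField E N) (x : N) :
    torsionLin h cov x (X x) (Y x) (Z x) = torsionForm h cov X Y Z x := rfl

lemma isSkew_torsionForm_iff {cov : Connection E N} :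
    (torsionForm h cov).IsSkew ↔ ∀ x, IsSkew₃ (fun u v w ↦ torsionLin h cov x u v w) := by
  constructor
  · intro hs x u v w
    obtain ⟨X, hX, rfl⟩ := exists_diffAt_eq u
    obtain ⟨Y, hY, rfl⟩ := exists_diffAt_eq v
    obtain ⟨Z, hZ, rfl⟩ := exists_diffAt_eq w
    exact hs x X Y Z hX hY hZ
  · intro hs x X Y Z _ _ _
    exact hs x (X x) (Y x) (Z x)

/-- The Koszul formula for a metric connection with skew-symmetric torsion. -/
theorem inner_eq_of_isMetricConnection {cov : Connection E N} (hm : IsMetricConnection h cov)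
    (hs : (torsionForm h cov).IsSkew) {X Y Z : VField E N} {x : N} (hX : DiffAt X x)
    (hY : DiffAt Y x) (hZ : DiffAt Z x) :
    h.inner x (cov Y x (X x)) (Z x)
      = 1 / 2 * koszul h X Y Z x + 1 / 2 * torsionLin h cov x (X x) (Y x) (Z x) := by
  have t : ∀ X Y Z : VField E N, DiffAt X x → DiffAt Y x → DiffAt Z x →
      ip h (bracket X Y) Z x = h.inner x (cov Y x (X x)) (Z x) - h.inner x (cov X x (Y x)) (Z x)
        - torsionLin h cov x (X x) (Y x) (Z x) := by
    intro X Y Z hX hY _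
    change h.inner x (VectorField.mlieBracket 𝓘(ℝ, E) X Y x) (Z x) = _ - _ -
      h.inner x (cov.torsion x (X x) (Y x)) (Z x)
    rw [cov.torsion_apply hX hY]
    simp only [map_sub, sub_apply]
    ring
  have m : ∀ X Y Z : VField E N, DiffAt X x → DiffAt Y x → lieFun Z (ip h X Y) x
      = h.inner x (cov X x (Z x)) (Y x) + h.inner x (X x) (cov Y x (Z x)) :=
    fun X Y Z hX hY ↦ hm x X Y (Z x) hX hY
  have s1 := hs x X Y Z hX hY hZ
  have s2 := hs x X Z Y hX hZ hY
  have s3 := hs x Y Z X hY hZ hX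
  have s4 := hs x Y X Z hY hX hZ
  rw [koszul, m Y Z X hY hZ, m X Z Y hX hZ, m X Y Z hX hY, t X Y Z hX hY hZ, t X Z Y hX hZ hY,
    t Y Z X hY hZ hX, h.symm x (Y x), h.symm x (X x) (cov Z x (Y x)), h.symm x (X x) (cov Y x (Z x))]
  simp only [torsionLin_apply]
  linarith [s1.1, s1.2, s2.1, s2.2, s3.1, s3.2, s4.1, s4.2]

/-- For a metric connection with skew-symmetric torsion, `∇F = 0` is an algebraic equation on the
torsion. -/
theorem isFConnection_iff (hF : IsRiemannianFStructure h F) {cov : Connection E N}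
    (hm : IsMetricConnection h cov) (hs : (torsionForm h cov).IsSkew) :
    IsFConnection F cov ↔ ∀ x, IsParallelEq (F.lin x) (derivF hF x)
      (fun u v w ↦ torsionLin h cov x u v w) := by
  have key : ∀ (x : N) (X Y Z : VField E N), DiffAt X x → DiffAt Y x → DiffAt Z x →
      h.inner x (cov (F.app Y) x (X x)) (Z x) - h.inner x (F x (cov Y x (X x))) (Z x)
        = derivF hF x (X x) (Y x) (Z x) + 1 / 2 * (torsionLin h cov x (X x) (F x (Y x)) (Z x)
          + torsionLin h cov x (X x) (Y x) (F x (Z x))) := by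
    intro x X Y Z hX hY hZ
    have hFY := hF.smooth.diffAt_app hY
    have hFZ := hF.smooth.diffAt_app hZ
    have a1 := inner_eq_of_isMetricConnection hm hs hX hFY hZ
    have a2 := inner_eq_of_isMetricConnection hm hs hX hY hFZ
    rw [derivF_eq_koszul hF hX hY hZ, hF.inner_app]
    simp only [EndField.app] at a1 a2 ⊢
    linarith
  constructor
  · intro hp x u v w
    obtain ⟨X, hX, rfl⟩ := exists_diffAt_eq u
    obtain ⟨Y, hY, rfl⟩ := exists_diffAt_eq v
    obtain ⟨Z, hZ, rfl⟩ := exists_diffAt_eq w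
    have k := key x X Y Z hX hY hZ
    rw [hp x Y (X x) hY, sub_self] at k
    change 2 * derivF hF x (X x) (Y x) (Z x) = -(torsionLin h cov x (X x) (F x (Y x)) (Z x)
      + torsionLin h cov x (X x) (Y x) (F x (Z x)))
    linarith
  · intro hp x Y u hY
    obtain ⟨X, hX, rfl⟩ := exists_diffAt_eq u
    refine ext_inner h fun Z hZ ↦ ?_
    have k := key x X Y Z hX hY hZ
    have e := hp x (X x) (Y x) (Z x)
    simp only [EndField.lin, ContinuousLinearMap.coe_coe] at e
    linarith

/-- The connection `D + T / 2`, where `D` is the Levi-Civita connection and `T` is a field of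
trilinear forms. -/
def leviCivitaAdd (h : Metric E N) (T : Π x : N, TangentSpace 𝓘(ℝ, E) x →ₗ[ℝ]
      TangentSpace 𝓘(ℝ, E) x →ₗ[ℝ] TangentSpace 𝓘(ℝ, E) x →ₗ[ℝ] ℝ) : Connection E N :=
  (leviCivita h).addOneForm fun x ↦
    haveI : FiniteDimensional ℝ (TangentSpace 𝓘(ℝ, E) x) := inferInstanceAs (FiniteDimensional ℝ E)
    haveI : T2Space (TangentSpace 𝓘(ℝ, E) x) := inferInstanceAs (T2Space E)
    LinearMap.toContinuousBilinearMap <|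
      -- The one-form takes the value of the differentiated field first and the direction second,
      -- the reverse of the order in `T`.
      LinearMap.mk₂ ℝ (fun v u ↦
        (flat h x).symm ((1 / 2 : ℝ) • LinearMap.toContinuousLinearMap (T x u v)))
      (fun a b u ↦ by simp) (fun c a u ↦ by simp [smul_comm c])
      (fun v a b ↦ by simp) (fun c v a ↦ by simp [smul_comm c])

variable {T : Π x : N, TangentSpace 𝓘(ℝ, E) x →ₗ[ℝ]
      TangentSpace 𝓘(ℝ, E) x →ₗ[ℝ] TangentSpace 𝓘(ℝ, E) x →ₗ[ℝ] ℝ}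

lemma inner_leviCivitaAdd (Y : VField E N) {x : N} (u w : TangentSpace 𝓘(ℝ, E) x) :
    h.inner x (leviCivitaAdd h T Y x u) w
      = h.inner x (leviCivita h Y x u) w + 1 / 2 * T x u (Y x) w := by
  change h.inner x (leviCivita h Y x u + (flat h x).symm ((1 / 2 : ℝ) • _)) w = _
  rw [map_add, add_apply, inner_flat_symm]
  rfl

variable (hT : ∀ x, IsSkew₃ (fun u v w ↦ T x u v w))
include hT

lemma isMetricConnection_leviCivitaAdd : IsMetricConnection h (leviCivitaAdd h T) := by
  intro x X Y u hX hY
  have s := (hT x u (X x) (Y x)).2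
  rw [leviCivita_metric h x X Y u hX hY, h.symm x (X x) (leviCivitaAdd h T Y x u),
    inner_leviCivitaAdd, inner_leviCivitaAdd, h.symm x (X x)]
  simp only at s
  linarith

/-- D has no torsion, so the torsion is (T(X, Y) - T(Y, X))/2, which is T by skewness. -/
lemma torsionLin_leviCivitaAdd (x : N) : torsionLin h (leviCivitaAdd h T) x = T x := by
  ext u v w
  obtain ⟨X, hX, rfl⟩ := exists_diffAt_eq u
  obtain ⟨Y, hY, rfl⟩ := exists_diffAt_eq v
  change h.inner x ((leviCivitaAdd h T).torsion x (X x) (Y x)) w = _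
  have b := bracket_eq (h := h) hX hY
  have s := (hT x (X x) (Y x) w).1
  rw [(leviCivitaAdd h T).torsion_apply hX hY]
  change h.inner x (_ - _ - bracket X Y x) w = _
  rw [b]
  simp only [map_sub, sub_apply, inner_leviCivitaAdd] at s ⊢
  linarith

omit hT in
lemma contMDiffCovariantDerivative_leviCivitaAdd
    (hs : ∀ (x : N) (X Y Z : VField E N), SmoothAt X x → SmoothAt Y x → SmoothAt Z x →
      ContMDiffAt 𝓘(ℝ, E) 𝓘(ℝ, ℝ) ∞ (fun y ↦ T y (X y) (Y y) (Z y)) x) :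
    (leviCivitaAdd h T).ContMDiffCovariantDerivative ∞ := by
  refine ⟨⟨fun {Y} hY ↦ ?_⟩⟩
  rw [contMDiffOn_univ] at hY ⊢
  have hY' : ∀ x, SmoothAt Y x := fun x ↦ (hY x).of_le (by simp)
  intro x
  refine contMDiffAt_endField_of_app fun X hX ↦ smoothAt_of_ip h fun Z hZ ↦ ?_
  have h1 := (contMDiffAt_const (c := (1 / 2 : ℝ))).mul (contMDiffAt_koszul h hX (hY' x) hZ)
  have h2 := (contMDiffAt_const (c := (1 / 2 : ℝ))).mul (hs x X Y Z hX (hY' x) hZ)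
  refine (h1.add h2).congr_of_eventuallyEq ?_
  filter_upwards [hX.eventually_diffAt, hZ.eventually_diffAt] with y hXy hZy
  change h.inner y (leviCivitaAdd h T Y y (X y)) (Z y) = _
  rw [inner_leviCivitaAdd, inner_leviCivita h hXy (hY' y).diffAt hZy]
  rfl

end MetricConnections

/-! ### Back to the manifold: necessity, uniqueness of the torsion, existence. -/

section Main

variable {E : Type*} [NormedAddCommGroup E] [NormedSpace ℝ E] [FiniteDimensional ℝ E]
  {N : Type*} [TopologicalSpace N] [ChartedSpace E N] [IsManifold 𝓘(ℝ, E) ∞ N]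

variable {h : Metric E N} {F : EndField E N} (hF : IsRiemannianFStructure h F)

lemma isReductive_iff : IsReductive h F ↔ ∀ x, AlgReductive (F.lin x) (derivF hF x) := by
  have hH := fun {X : VField E N} {x : N} (hX : DiffAt X x) ↦ hF.smooth.diffAt_projH hX
  have hV := fun {X : VField E N} {x : N} (hX : DiffAt X x) ↦ hF.smooth.diffAt_projV hX
  constructor
  · rintro ⟨h1, h2⟩ x
    constructor
    all_goals
      intro u v w
      obtain ⟨X, hX, rfl⟩ := exists_diffAt_eq u
      obtain ⟨Y, hY, rfl⟩ := exists_diffAt_eq v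
      obtain ⟨Z, hZ, rfl⟩ := exists_diffAt_eq w
    · have k := h1 x X Y Z hX hY hZ
      rw [TriForm.comp, TriForm.comp, derivProjV_eq hF (hH hX) (hH hY),
        derivProjV_eq hF (hH hY) (hH hX)] at k
      exact k
    · have k := h2 x X Y Z hX hY hZ
      rw [TriForm.comp, TriForm.comp, derivProjV_eq hF (hV hX) (hV hY),
        derivProjV_eq hF (hV hY) (hV hX)] at k
      exact k
  · intro hR
    constructor
    · intro x X Y Z hX hY hZ
      rw [TriForm.comp, TriForm.comp, derivProjV_eq hF (hH hX) (hH hY),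
        derivProjV_eq hF (hH hY) (hH hX)]
      exact (hR x).1 (X x) (Y x) (Z x)
    · intro x X Y Z hX hY hZ
      rw [TriForm.comp, TriForm.comp, derivProjV_eq hF (hV hX) (hV hY),
        derivProjV_eq hF (hV hY) (hV hX)]
      exact (hR x).2 (X x) (Y x) (Z x)

lemma extNijenhuis_eq {X Y Z : VField E N} {x : N} (hX : DiffAt X x) (hY : DiffAt Y x)
    (hZ : DiffAt Z x) :
    extNijenhuis h F X Y Z x = algExt (F.lin x) (derivF hF x) (X x) (Y x) (Z x) := by
  rw [extNijenhuis, nijenhuis_eq hF hX hY, curvH_eq hF hX hY, curvV_eq hF hZ hX,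
    curvV_eq hF hY hZ]
  rfl

lemma isGlobalTypeG1_iff :
    IsGlobalTypeG1 h F ↔ ∀ x, IsSkew₃ (algExt (F.lin x) (derivF hF x)) := by
  constructor
  · intro hG x u v w
    obtain ⟨X, hX, rfl⟩ := exists_diffAt_eq u
    obtain ⟨Y, hY, rfl⟩ := exists_diffAt_eq v
    obtain ⟨Z, hZ, rfl⟩ := exists_diffAt_eq w
    rw [← extNijenhuis_eq hF hX hY hZ, ← extNijenhuis_eq hF hY hX hZ,
      ← extNijenhuis_eq hF hX hZ hY]
    exact hG x X Y Z hX hY hZ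
  · intro hG x X Y Z hX hY hZ
    rw [extNijenhuis_eq hF hX hY hZ, extNijenhuis_eq hF hY hX hZ, extNijenhuis_eq hF hX hZ hY]
    exact hG x (X x) (Y x) (Z x)

/-- The torsion of the characteristic connections. -/
def charTorsion (h : Metric E N) (F : EndField E N) (α : VerticalThreeForm F) : TriForm E N :=
  (-dcFundForm h F + (nijenhuis h F).comp (projH F) (projH F) (projH F))
    + (curvH h F).cyc + (curvV h F).cyc + α.form

lemma charTorsion_eq (α : VerticalThreeForm F) {X Y Z : VField E N} {x : N} (hX : DiffAt X x)
    (hY : DiffAt Y x) (hZ : DiffAt Z x) :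
    charTorsion h F α X Y Z x
      = algT (F.lin x) (derivF hF x) (α.lin x) (X x) (Y x) (Z x) := by
  change -dcFundForm h F X Y Z x + nijenhuis h F _ _ _ x
    + (curvH h F X Y Z x + curvH h F Y Z X x + curvH h F Z X Y x)
    + (curvV h F X Y Z x + curvV h F Y Z X x + curvV h F Z X Y x) + α.form X Y Z x = _
  rw [dcFundForm_eq hF hX hY hZ, nijenhuis_eq hF (hF.smooth.diffAt_projH hX)
    (hF.smooth.diffAt_projH hY), curvH_eq hF hX hY, curvH_eq hF hY hZ, curvH_eq hF hZ hX,
    curvV_eq hF hX hY, curvV_eq hF hY hZ, curvV_eq hF hZ hX, neg_neg]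
  rfl

/-- The torsion of the characteristic connection, as a field of trilinear maps. -/
def charTorsionLin (hF : IsRiemannianFStructure h F) (α : VerticalThreeForm F) (x : N) :
    TangentSpace 𝓘(ℝ, E) x →ₗ[ℝ] TangentSpace 𝓘(ℝ, E) x →ₗ[ℝ] TangentSpace 𝓘(ℝ, E) x →ₗ[ℝ] ℝ :=
  trilinearMk (algT (F.lin x) (derivF hF x) (α.lin x))
    (fun a b v w ↦ by
      simp only [algT, algD, algN, algPhi, algR, map_add, LinearMap.add_apply]; ring)
    (fun c a v w ↦ by
      simp only [algT, algD, algN, algPhi, algR, map_smul, LinearMap.smul_apply, smul_eq_mul]; ring)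
    (fun u a b w ↦ by
      simp only [algT, algD, algN, algPhi, algR, map_add, LinearMap.add_apply]; ring)
    (fun c u a w ↦ by
      simp only [algT, algD, algN, algPhi, algR, map_smul, LinearMap.smul_apply, smul_eq_mul]; ring)
    (fun u v a b ↦ by
      simp only [algT, algD, algN, algPhi, algR, map_add, LinearMap.add_apply]; ring)
    (fun c u v a ↦ by
      simp only [algT, algD, algN, algPhi, algR, map_smul, LinearMap.smul_apply, smul_eq_mul]; ring)

lemma contMDiffAt_derivF {X Y Z : VField E N} {x : N} (hX : SmoothAt X x) (hY : SmoothAt Y x)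
    (hZ : SmoothAt Z x) :
    ContMDiffAt 𝓘(ℝ, E) 𝓘(ℝ, ℝ) ∞ (fun y ↦ derivF hF y (X y) (Y y) (Z y)) x := by
  have h1 := (contMDiffAt_const (c := (1 / 2 : ℝ))).mul (contMDiffAt_koszul h hX (hF.smooth.smoothAt_app hY) hZ)
  have h2 := (contMDiffAt_const (c := (1 / 2 : ℝ))).mul (contMDiffAt_koszul h hX hY (hF.smooth.smoothAt_app hZ))
  refine (h1.add h2).congr_of_eventuallyEq ?_
  filter_upwards [hX.eventually_diffAt, hY.eventually_diffAt, hZ.eventually_diffAt]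
    with y hXy hYy hZy
  rw [derivF_eq_koszul hF hXy hYy hZy]
  rfl

lemma contMDiffAt_charTorsionLin (α : VerticalThreeForm F) {X Y Z : VField E N} {x : N}
    (hX : SmoothAt X x) (hY : SmoothAt Y x) (hZ : SmoothAt Z x) :
    ContMDiffAt 𝓘(ℝ, E) 𝓘(ℝ, ℝ) ∞ (fun y ↦ charTorsionLin hF α y (X y) (Y y) (Z y)) x := by
  have sF := fun {X : VField E N} (hX : SmoothAt X x) ↦ hF.smooth.smoothAt_app hX
  have sH := fun {X : VField E N} (hX : SmoothAt X x) ↦ hF.smooth.smoothAt_projH hX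
  have sV := fun {X : VField E N} (hX : SmoothAt X x) ↦ hF.smooth.smoothAt_projV hX
  have d := fun {X Y Z : VField E N} (hX : SmoothAt X x) (hY : SmoothAt Y x)
    (hZ : SmoothAt Z x) ↦ contMDiffAt_derivF hF hX hY hZ
  have hD := ((d (sF hX) (sF hY) (sF hZ)).add (d (sF hY) (sF hZ) (sF hX))).add
    (d (sF hZ) (sF hX) (sF hY))
  have hN := fun {X Y Z : VField E N} (hX : SmoothAt X x) (hY : SmoothAt Y x)
    (hZ : SmoothAt Z x) ↦ (((d (sF hX) hY hZ).sub (d (sF hY) hX hZ)).add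
      (d hX hY (sF hZ))).sub (d hY hX (sF hZ))
  have hP := fun {X Y Z : VField E N} (hX : SmoothAt X x) (hY : SmoothAt Y x)
    (hZ : SmoothAt Z x) ↦ (d (sH hX) (sF hY) (sV hZ)).sub (d (sH hY) (sF hX) (sV hZ))
  have hR := fun {X Y Z : VField E N} (hX : SmoothAt X x) (hY : SmoothAt Y x)
    (hZ : SmoothAt Z x) ↦ (d (sV hX) (sV hY) (sF hZ)).sub (d (sV hY) (sV hX) (sF hZ))
  exact (((hD.add (hN (sH hX) (sH hY) (sH hZ))).add
    (((hP hX hY hZ).add (hP hY hZ hX)).add (hP hZ hX hY))).add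
    (((hR hX hY hZ).add (hR hY hZ hX)).add (hR hZ hX hY))).add (α.smooth x X Y Z hX hY hZ)

include hF in
/-- A Riemannian `f`-manifold with a characteristic connection is reductive and of global type
`𝒢₁`. -/
theorem reductive_and_globalTypeG1_of_isCharacteristic {cov : Connection E N}
    (hc : IsCharacteristic h F cov) : IsReductive h F ∧ IsGlobalTypeG1 h F := by
  have hE := (isFConnection_iff hF hc.metric hc.skew).1 hc.parallel
  have hT := isSkew_torsionForm_iff.1 hc.skew
  exact ⟨(isReductive_iff hF).2 fun x ↦
      algReductive_of_isParallelEq (isDerivOfF_derivF hF x) (hT x) (hE x),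
    (isGlobalTypeG1_iff hF).2 fun x ↦
      isSkew_algExt_of_isParallelEq (isDerivOfF_derivF hF x) (hT x) (hE x)⟩

/-- The torsion of a characteristic connection is determined by its vertical part. -/
theorem torsionLin_eq_of_isCharacteristic {cov : Connection E N}
    (hc : IsCharacteristic h F cov) {α : VerticalThreeForm F}
    (hα : ((torsionForm h cov).comp (projV F) (projV F) (projV F)).Agrees α.form) (x : N) :
    torsionLin h cov x = charTorsionLin hF α x := by
  have hE := (isFConnection_iff hF hc.metric hc.skew).1 hc.parallel
  have hT := isSkew_torsionForm_iff.1 hc.skew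
  ext u v w
  refine eq_algT_of_isParallelEq (isDerivOfF_derivF hF x) (hT x) (hE x) (fun u v w ↦ ?_) u v w
  obtain ⟨X, hX, rfl⟩ := exists_diffAt_eq u
  obtain ⟨Y, hY, rfl⟩ := exists_diffAt_eq v
  obtain ⟨Z, hZ, rfl⟩ := exists_diffAt_eq w
  exact hα x X Y Z hX hY hZ

/-- Existence of the characteristic connection with prescribed vertical torsion. -/
theorem isCharacteristic_leviCivitaAdd (hR : IsReductive h F) (hG : IsGlobalTypeG1 h F)
    (α : VerticalThreeForm F) :
    IsCharacteristic h F (leviCivitaAdd h (charTorsionLin hF α)) ∧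
      ∀ x, torsionLin h (leviCivitaAdd h (charTorsionLin hF α)) x = charTorsionLin hF α x := by
  have hR' := (isReductive_iff hF).1 hR
  have hG' := (isGlobalTypeG1_iff hF).1 hG
  have hT : ∀ x, IsSkew₃ (fun u v w ↦ charTorsionLin hF α x u v w) := fun x ↦
    isSkew_algT (isDerivOfF_derivF hF x) (hG' x) (α.isSkew_lin x)
  have ht := torsionLin_leviCivitaAdd (h := h) hT
  have hs : (torsionForm h (leviCivitaAdd h (charTorsionLin hF α))).IsSkew :=
    isSkew_torsionForm_iff.2 fun x ↦ by rw [ht]; exact hT x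
  have hm := isMetricConnection_leviCivitaAdd (h := h) hT
  refine ⟨⟨contMDiffCovariantDerivative_leviCivitaAdd fun x X Y Z hX hY hZ ↦
    contMDiffAt_charTorsionLin hF α hX hY hZ, hm, (isFConnection_iff hF hm hs).2 fun x ↦ ?_, hs⟩,
    ht⟩
  rw [ht]
  exact isParallelEq_algT (isDerivOfF_derivF hF x) (hR' x) (hG' x) α.lin_vertical

end Main

end FManifold

end

theorem mainTheorem2
    {E : Type*} [NormedAddCommGroup E] [NormedSpace ℝ E] [FiniteDimensional ℝ E]
    {N : Type*} [TopologicalSpace N] [T2Space N] [ChartedSpace E N] [IsManifold 𝓘(ℝ, E) ∞ N]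
    (h : FManifold.Metric E N) (F : FManifold.EndField E N)
    (hF : FManifold.IsRiemannianFStructure h F) :
    ((∃ cov : FManifold.Connection E N, FManifold.IsCharacteristic h F cov) ↔
      FManifold.IsReductive h F ∧ FManifold.IsGlobalTypeG1 h F) ∧
    (FManifold.IsReductive h F → FManifold.IsGlobalTypeG1 h F →
      ∀ α : FManifold.VerticalThreeForm F,
        ∃ cov : FManifold.Connection E N,
          (FManifold.IsCharacteristic h F cov ∧
            ((FManifold.torsionForm h cov).comp (FManifold.projV F) (FManifold.projV F)
              (FManifold.projV F)).Agrees α.form) ∧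
          (∀ cov' : FManifold.Connection E N,
            FManifold.IsCharacteristic h F cov' →
            ((FManifold.torsionForm h cov').comp (FManifold.projV F) (FManifold.projV F)
              (FManifold.projV F)).Agrees α.form →
            FManifold.SameConnection cov' cov) ∧
          (FManifold.torsionForm h cov).Agrees
            ((-FManifold.dcFundForm h F
                + (FManifold.nijenhuis h F).comp (FManifold.projH F) (FManifold.projH F)
                    (FManifold.projH F))
              + (FManifold.curvH h F).cyc + (FManifold.curvV h F).cyc + α.form)) := by
  refine ⟨⟨fun ⟨cov, hc⟩ ↦ FManifold.reductive_and_globalTypeG1_of_isCharacteristic hF hc,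
    fun ⟨hR, hG⟩ ↦ ?_⟩, fun hR hG α ↦ ?_⟩
  -- Any vertical form would do; zero is always available.
  · let α : FManifold.VerticalThreeForm F :=
      { toFun := fun _ ↦ 0
        smooth := fun _ _ _ _ _ _ _ ↦ contMDiffAt_const
        vertical := fun _ _ _ _ ↦ rfl }
    exact ⟨_, (FManifold.isCharacteristic_leviCivitaAdd hF hR hG α).1⟩
  · obtain ⟨hc, ht⟩ := FManifold.isCharacteristic_leviCivitaAdd hF hR hG α
    refine ⟨_, ⟨hc, fun x X Y Z _ _ _ ↦ ?_⟩, fun cov' hc' hα' x Y hY ↦ ?_,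
      fun x X Y Z hX hY hZ ↦ ?_⟩
    · change FManifold.torsionLin h _ x (FManifold.projV F x (X x)) (FManifold.projV F x (Y x))
        (FManifold.projV F x (Z x)) = _
      rw [ht]
      exact FManifold.algT_vertical (FManifold.isDerivOfF_derivF hF x) α.lin_vertical _ _ _
    -- A metric connection with skew torsion is determined by its torsion, and both torsions equal
    -- the same `charTorsionLin`.
    · refine FManifold.ext_field fun X hX ↦ FManifold.ext_inner h fun Z hZ ↦ ?_
      rw [FManifold.inner_eq_of_isMetricConnection hc'.metric hc'.skew hX hY hZ,
        FManifold.inner_eq_of_isMetricConnection hc.metric hc.skew hX hY hZ, ht,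
        FManifold.torsionLin_eq_of_isCharacteristic hF hc' hα']
    · change FManifold.torsionLin h _ x (X x) (Y x) (Z x) = FManifold.charTorsion h F α X Y Z x
      rw [ht, FManifold.charTorsion_eq hF α hX hY hZ]
      rfl
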